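/- A graph is AT-free if it has no asteroidal triple, that is, no three distinct pairwise nonadjacent vertices such that every two of them are joined by a path that avoids the closed neighborhood of the third. Solitaire Flood-It is played on a finite connected graph $G$ with a source vertex $v_0$ and an arbitrary (not necessarily proper) coloring $c:V(G)\to C$, where $C$ is a set of $k$ colors. At any time the territory of the player is the set of vertices that can be reached from $v_0$ by a path all of whose vertices have the current color of $v_0$. A move consists of calling a color $i\in C$: all vertices of the territory are recolored with $i$ (so that the territory then also contains the vertices that can now be reached from $v_0$ by a path of color $i$). The aim is to make the territory equal to $V(G)$ in as few moves as possible. **Theorem.** The minimal number of moves in solitaire Flood-It can be computed in polynomial time on AT-free graphs. Precisely: there are a single random access machine program (unit-cost memory access, addition, truncated subtraction and zero test on natural numbers; no multiplication) and constants $C_0,d\in\mathbb{N}$ such that for all $n$ and $k$, every connected AT-free graph $G$ with vertex set $\{0,\dots,n-1\}$, every source $v_0\in V(G)$ and every coloring $c:V(G)\to\{0,\dots,k-1\}$, the program, started with $n$, $k$, $v_0$, the colors of the vertices and the adjacency matrix of $G$ in its memory, halts after at most $C_0\,n^d$ units of time and outputs the minimal number of moves that conquers all vertices of $G$ from $v_0$.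 -/

import Mathlib

namespace FloodIt

/-! ### Asteroidal triples -/

section Graphs

variable {V : Type*}

/-- Some path of `G` joins `x` and `y` and avoids the closed neighborhood `N[z]`. -/
def JoinedAvoiding (G : SimpleGraph V) (x y z : V) : Prop :=
  ∃ p : G.Walk x y, p.IsPath ∧ ∀ v ∈ p.support, v ≠ z ∧ ¬ G.Adj z v

/-- `x, y, z` is an asteroidal triple: three distinct, pairwise nonadjacent vertices, each two of
which are joined by a path that avoids the closed neighborhood of the third. -/
structure IsAsteroidalTriple (G : SimpleGraph V) (x y z : V) : Prop where
  ne_xy : x ≠ y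
  ne_yz : y ≠ z
  ne_xz : x ≠ z
  not_adj_xy : ¬ G.Adj x y
  not_adj_yz : ¬ G.Adj y z
  not_adj_xz : ¬ G.Adj x z
  joined_xy : JoinedAvoiding G x y z
  joined_yz : JoinedAvoiding G y z x
  joined_xz : JoinedAvoiding G x z y

/-- A graph is AT-free if it has no asteroidal triple. -/
def ATFree (G : SimpleGraph V) : Prop :=
  ∀ x y z : V, ¬ IsAsteroidalTriple G x y z

/-! ### The solitaire game -/

variable {K : Type*}

/-- The territory of the source `s` under the coloring `c`: all vertices that can be reached from
`s` by a walk whose vertices all have the color of `s`. -/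
def territory (G : SimpleGraph V) (s : V) (c : V → K) : Set V :=
  {v | ∃ p : G.Walk s v, ∀ u ∈ p.support, c u = c s}

open Classical in
/-- The coloring after the player calls color `i`: his territory is recolored with `i`. (The
vertices that join the territory are those in the territory of the new coloring.) -/
noncomputable def move (G : SimpleGraph V) (s : V) (c : V → K) (i : K) : V → K :=
  fun v => if v ∈ territory G s c then i else c v

/-- The coloring after the player calls the colors of a list, from left to right. -/
noncomputable def play (G : SimpleGraph V) (s : V) (c : V → K) (γ : List K) : V → K :=
  γ.foldl (move G s) c

/-- The list `γ` of colors is a (winning) strategy: at its end the territory is everything. -/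
def IsStrategy (G : SimpleGraph V) (s : V) (c : V → K) (γ : List K) : Prop :=
  territory G s (play G s c γ) = Set.univ

/-- `m` is the minimal number of moves in which the player can conquer all vertices. -/
def IsMinMoves (G : SimpleGraph V) (s : V) (c : V → K) (m : ℕ) : Prop :=
  IsLeast {l : ℕ | ∃ γ : List K, γ.length = l ∧ IsStrategy G s c γ} m

end Graphs

/-! ### Random access machine

Programs of a random access machine whose memory consists of arrays of natural numbers, indexed
by natural numbers. (A program mentions only finitely many arrays, by literal names.)
The arithmetic operations are addition and truncated subtraction, each taking one unit of time;
there is no multiplication and no shift, so that a value can at most double with each unit of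
time, and running times are polynomially related to those of Turing machines. -/

/-- The memory: `σ a i` is the content of cell `i` of array `a`. -/
abbrev Memory : Type := ℕ → ℕ → ℕ

/-- Write `v` to cell `i` of array `a`. -/
def Memory.write (σ : Memory) (a i v : ℕ) : Memory :=
  fun a' i' => if a' = a ∧ i' = i then v else σ a' i'

/-- Expressions: literals, the content of a cell, sums and truncated differences. -/
inductive Expr : Type
  | lit (n : ℕ) : Expr
  | read (a : ℕ) (i : Expr) : Expr
  | add (e f : Expr) : Expr
  | sub (e f : Expr) : Expr

/-- The value of an expression. -/
def Expr.eval (σ : Memory) : Expr → ℕ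
  | .lit n => n
  | .read a i => σ a (i.eval σ)
  | .add e f => e.eval σ + f.eval σ
  | .sub e f => e.eval σ - f.eval σ

/-- The time for evaluating an expression: one unit for each literal, read and operation. -/
def Expr.cost : Expr → ℕ
  | .lit _ => 1
  | .read _ i => i.cost + 1
  | .add e f => e.cost + f.cost + 1
  | .sub e f => e.cost + f.cost + 1

/-- Programs. -/
inductive Prog : Type
  | skip : Prog
  /-- write the value of `e` to the cell of array `a` whose index is the value of `i` -/
  | write (a : ℕ) (i e : Expr) : Prog
  | seq (p q : Prog) : Prog
  /-- run `p` if the value of `e` is not zero, and `q` otherwise -/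
  | ite (e : Expr) (p q : Prog) : Prog
  /-- run `p` as long as the value of `e` is not zero -/
  | loop (e : Expr) (p : Prog) : Prog

/-- `Runs p σ τ t`: started with memory `σ`, the program `p` halts after exactly `t` units of time
with memory `τ`. -/
inductive Runs : Prog → Memory → Memory → ℕ → Prop
  | skip (σ : Memory) : Runs .skip σ σ 1
  | write (a : ℕ) (i e : Expr) (σ : Memory) :
      Runs (.write a i e) σ (σ.write a (i.eval σ) (e.eval σ)) (i.cost + e.cost + 1)
  | seq {p q : Prog} {σ τ ρ : Memory} {t u : ℕ} (hp : Runs p σ τ t) (hq : Runs q τ ρ u) :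
      Runs (.seq p q) σ ρ (t + u)
  | ite_true {e : Expr} {p q : Prog} {σ τ : Memory} {t : ℕ} (he : e.eval σ ≠ 0)
      (hp : Runs p σ τ t) : Runs (.ite e p q) σ τ (e.cost + t + 1)
  | ite_false {e : Expr} {p q : Prog} {σ τ : Memory} {t : ℕ} (he : e.eval σ = 0)
      (hq : Runs q σ τ t) : Runs (.ite e p q) σ τ (e.cost + t + 1)
  | loop_true {e : Expr} {p : Prog} {σ τ ρ : Memory} {t u : ℕ} (he : e.eval σ ≠ 0)
      (hp : Runs p σ τ t) (hl : Runs (.loop e p) τ ρ u) :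
      Runs (.loop e p) σ ρ (e.cost + t + u + 1)
  | loop_false {e : Expr} {p : Prog} {σ : Memory} (he : e.eval σ = 0) :
      Runs (.loop e p) σ σ (e.cost + 1)

/-! ### Input and output -/

open Classical in
/-- The memory that holds an instance of the game. Array `0` holds the number `n` of vertices, the
number `k` of colors and the source; array `1` holds the colors of the vertices; array `2` holds
the adjacency matrix, row by row. All other cells are `0`. -/
noncomputable def input {n k : ℕ} (G : SimpleGraph (Fin n)) (s : Fin n) (c : Fin n → Fin k) :
    Memory
  | 0, 0 => n
  | 0, 1 => k
  | 0, 2 => s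
  | 1, i => if h : i < n then (c ⟨i, h⟩ : ℕ) else 0
  | 2, i => if ∃ u v : Fin n, i = u * n + v ∧ G.Adj u v then 1 else 0
  | _, _ => 0

/-- The answer of a program is the content of cell `0` of array `3`. -/
def output (σ : Memory) : ℕ := σ 3 0

end FloodIt

/-! Contract the monochromatic components (blocks). For `Near`, equality or adjacency of blocks, a
call adds to the territory exactly the vertices of the called original color that are near it
(`isStrategy_iff`). Contraction creates no asteroidal triple (`joinedAvoiding_of_avoid`), and near
vertices of equal color become twins (`ATFree.isTame`).

The territory is connected and contains the source `s`. If it contains `x`, it therefore dominates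
every `v` whose closed neighborhood meets all walks from `s` to `x`, that is, `¬ Avoid nr v s x`.
Five owned vertices retain enough of this information. Two dominate the vertices whose conquest
still has to be watched: three irredundant ones would yield an asteroidal triple
(`IsTame.exists_cover`). Three dominate what is already owned: an irredundant set for the preorder
`Below` is pairwise unrelated, and four unrelated vertices are impossible (`IsTame.exists_below`).

Every color outside the first territory has to be called once. A call whose color is completely
dominated by the five vertices pays for its color; any other call is extra. Once everything is
dominated, each remaining color is called once. So the optimum is the number of colors left plus the
least number of extra calls for which `Wins` holds: `Wins.exists_run` turns states into strategies,
`IsTame.exists_wins` strategies into states, and `isMinMoves_of_atFree` combines them.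

`Wins` is a recursion over tuples of one number and five vertices. Since `n` rounds and fewer than
`n` extra calls suffice, it is computed by refilling a table with `n ^ 6` entries `n` times. Colors
are only compared for equality, so the running time does not depend on `k`. The algorithm is written
in a small language whose loops all run below `n`; its compilation has a polynomial time bound by
structural recursion. -/

namespace FloodIt

/-! ### A small structured language and its compilation -/

/-- Terms over numbered variables and the arrays of the memory. A sum ranges over the numbers below
the content of cell `0` of array `0`. -/
inductive Term : Type
  | lit (n : ℕ) : Term
  | var (x : ℕ) : Term
  | rd (a : ℕ) (h : Term) : Term
  | add (h k : Term) : Term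
  | sub (h k : Term) : Term
  | sum (x : ℕ) (h : Term) : Term

/-- The value of a term. -/
def Term.eval (σ : Memory) : Term → (ℕ → ℕ) → ℕ
  | .lit n, _ => n
  | .var x, ρ => ρ x
  | .rd a h, ρ => σ a (h.eval σ ρ)
  | .add h k, ρ => h.eval σ ρ + k.eval σ ρ
  | .sub h k, ρ => h.eval σ ρ - k.eval σ ρ
  | .sum x h, ρ => ∑ j ∈ Finset.range (σ 0 0), h.eval σ (Function.update ρ x j)

/-- The arrays that a term reads. -/
def Term.reads : Term → List ℕ
  | .lit _ => []
  | .var _ => []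
  | .rd a h => a :: h.reads
  | .add h k => h.reads ++ k.reads
  | .sub h k => h.reads ++ k.reads
  | .sum _ h => 0 :: h.reads

theorem Term.eval_congr {σ τ : Memory} (h : Term) (ρ : ℕ → ℕ) (H : ∀ a ∈ h.reads, σ a = τ a) :
    h.eval σ ρ = h.eval τ ρ := by
  induction h generalizing ρ with
  | lit n => rfl
  | var x => rfl
  | rd a h ih =>
    simp only [Term.reads, List.mem_cons, forall_eq_or_imp] at H
    simp only [Term.eval, H.1, ih ρ H.2]
  | add h k ih ik =>
    simp only [Term.reads, List.mem_append] at H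
    simp only [Term.eval, ih ρ fun a ha => H a (.inl ha), ik ρ fun a ha => H a (.inr ha)]
  | sub h k ih ik =>
    simp only [Term.reads, List.mem_append] at H
    simp only [Term.eval, ih ρ fun a ha => H a (.inl ha), ik ρ fun a ha => H a (.inr ha)]
  | sum x h ih =>
    simp only [Term.reads, List.mem_cons, forall_eq_or_imp] at H
    simp only [Term.eval, H.1]
    exact Finset.sum_congr rfl fun j _ => ih _ H.2

/-- Arrays `4` and `5` are reserved for the variables and the temporary values. -/
def Term.Ok (h : Term) : Prop := 4 ∉ h.reads ∧ 5 ∉ h.reads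

instance (h : Term) : Decidable h.Ok := inferInstanceAs (Decidable (_ ∧ _))

/-- Agreement of two memories outside the reserved arrays. -/
def Agree (σ τ : Memory) : Prop := ∀ a, a ≠ 4 → a ≠ 5 → σ a = τ a

theorem Agree.refl (σ : Memory) : Agree σ σ := fun _ _ _ => rfl

theorem Agree.trans {σ τ υ : Memory} (h : Agree σ τ) (k : Agree τ υ) : Agree σ υ :=
  fun a h4 h5 => (h a h4 h5).trans (k a h4 h5)

theorem Agree.eval {σ τ : Memory} (H : Agree σ τ) {h : Term} (ok : h.Ok) (ρ : ℕ → ℕ) :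
    h.eval σ ρ = h.eval τ ρ :=
  h.eval_congr ρ fun a ha => H a (fun e => ok.1 (e ▸ ha)) (fun e => ok.2 (e ▸ ha))

/-- The temporary cell number `k`. -/
def tmp (k : ℕ) : Expr := .read 5 (.lit k)

/-- The cell of the variable number `x`. -/
def vr (x : ℕ) : Expr := .read 4 (.lit x)

/-- The program that puts the value of a term into the temporary cell `k` and changes no
temporary cell below `k`. -/
def Term.comp : Term → ℕ → Prog
  | .lit n, k => .write 5 (.lit k) (.lit n)
  | .var x, k => .write 5 (.lit k) (vr x)
  | .rd a h, k => .seq (h.comp k) (.write 5 (.lit k) (.read a (tmp k)))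
  | .add h g, k => .seq (h.comp k) (.seq (g.comp (k + 1))
      (.write 5 (.lit k) (.add (tmp k) (tmp (k + 1)))))
  | .sub h g, k => .seq (h.comp k) (.seq (g.comp (k + 1))
      (.write 5 (.lit k) (.sub (tmp k) (tmp (k + 1)))))
  | .sum x h, k =>
    .seq (.write 5 (.lit k) (.lit 0)) <| .seq (.write 5 (.lit (k + 1)) (.lit 0)) <|
    .seq (.write 5 (.lit (k + 2)) (vr x)) <|
    .seq (.loop (.sub (.read 0 (.lit 0)) (tmp (k + 1))) <|
      .seq (.write 4 (.lit x) (tmp (k + 1))) <| .seq (h.comp (k + 3)) <|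
      .seq (.write 5 (.lit k) (.add (tmp k) (tmp (k + 3))))
        (.write 5 (.lit (k + 1)) (.add (tmp (k + 1)) (.lit 1))))
    (.write 4 (.lit x) (tmp (k + 2)))

/-- A bound for the running time of the compiled term. -/
def Term.time (n : ℕ) : Term → ℕ
  | .lit _ => 3
  | .var _ => 4
  | .rd _ h => h.time n + 5
  | .add h g => h.time n + g.time n + 7
  | .sub h g => h.time n + g.time n + 7
  | .sum _ h => n * (h.time n + 23) + 22

/-- Induction on the number of remaining rounds. A round costs the body, the test and one unit; the
last, failing test accounts for the additive term. -/
theorem exists_runs_loop {e : Expr} {p : Prog} (m B : ℕ) (Inv : ℕ → Memory → Prop)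
    (hstep : ∀ j < m, ∀ σ, Inv j σ →
      e.eval σ ≠ 0 ∧ ∃ τ t, Runs p σ τ t ∧ t ≤ B ∧ Inv (j + 1) τ)
    (hend : ∀ σ, Inv m σ → e.eval σ = 0) (σ : Memory) (h0 : Inv 0 σ) :
    ∃ τ t, Runs (.loop e p) σ τ t ∧ t ≤ m * (B + e.cost + 1) + e.cost + 1 ∧ Inv m τ := by
  suffices H : ∀ d j σ, j + d = m → Inv j σ →
      ∃ τ t, Runs (.loop e p) σ τ t ∧ t ≤ d * (B + e.cost + 1) + e.cost + 1 ∧ Inv m τ from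
    H m 0 σ (by omega) h0
  intro d
  induction d with
  | zero =>
    intro j σ hj hI
    obtain rfl : j = m := by omega
    exact ⟨σ, _, .loop_false (hend σ hI), by omega, hI⟩
  | succ d ih =>
    intro j σ hj hI
    obtain ⟨he, τ, t, hr, ht, hI'⟩ := hstep j (by omega) σ hI
    obtain ⟨υ, u, hu, hut, hIu⟩ := ih (j + 1) τ (by omega) hI'
    refine ⟨υ, _, .loop_true he hr hu, ?_, hIu⟩
    rw [Nat.add_mul]
    omega

theorem Memory.write_same (σ : Memory) (a i v : ℕ) : σ.write a i v a i = v := by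
  simp [Memory.write]

theorem Memory.write_of_ne_cell (σ : Memory) {a i v a' i' : ℕ} (h : i' ≠ i) :
    σ.write a i v a' i' = σ a' i' := by
  simp [Memory.write, h]

theorem Memory.write_of_ne (σ : Memory) {a i v a' : ℕ} (h : a' ≠ a) :
    σ.write a i v a' = σ a' := by
  funext i'
  simp [Memory.write, h]

theorem Memory.write_array (σ : Memory) (a i v : ℕ) :
    σ.write a i v a = Function.update (σ a) i v := by
  funext i'
  simp [Memory.write, Function.update_apply]

theorem Agree.of_write {σ τ : Memory} (h : Agree σ τ) {a : ℕ} (ha : a = 4 ∨ a = 5) (i v : ℕ) :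
    Agree (σ.write a i v) τ := by
  intro a' h4 h5
  rw [Memory.write_of_ne _ (by omega)]
  exact h a' h4 h5

/-- The temporary cells act as a stack: preserving everything below `k` lets an intermediate result
survive the evaluation of the next subterm. -/
theorem Term.exists_runs_comp (h : Term) (ok : h.Ok) (k : ℕ) (σ : Memory) :
    ∃ τ t, Runs (h.comp k) σ τ t ∧ t ≤ h.time (σ 0 0) ∧ τ 5 k = h.eval σ (σ 4) ∧
      Agree τ σ ∧ τ 4 = σ 4 ∧ ∀ j < k, τ 5 j = σ 5 j := by
  -- Sums and differences are handled together, with `op` for the machine operation and `f` for its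
  -- meaning.
  have bin : ∀ (h g : Term) (op : Expr → Expr → Expr) (f : ℕ → ℕ → ℕ)
      (_ : ∀ e e' σ, (op e e').eval σ = f (e.eval σ) (e'.eval σ))
      (_ : ∀ e e', (op e e').cost = e.cost + e'.cost + 1) (_ : g.Ok)
      (_ : ∀ k σ, ∃ τ t, Runs (h.comp k) σ τ t ∧ t ≤ h.time (σ 0 0) ∧ τ 5 k = h.eval σ (σ 4) ∧
        Agree τ σ ∧ τ 4 = σ 4 ∧ ∀ j < k, τ 5 j = σ 5 j)
      (_ : ∀ k σ, ∃ τ t, Runs (g.comp k) σ τ t ∧ t ≤ g.time (σ 0 0) ∧ τ 5 k = g.eval σ (σ 4) ∧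
        Agree τ σ ∧ τ 4 = σ 4 ∧ ∀ j < k, τ 5 j = σ 5 j) (k : ℕ) (σ : Memory),
      ∃ τ t, Runs (.seq (h.comp k) (.seq (g.comp (k + 1))
        (.write 5 (.lit k) (op (tmp k) (tmp (k + 1)))))) σ τ t ∧
        t ≤ h.time (σ 0 0) + g.time (σ 0 0) + 7 ∧
        τ 5 k = f (h.eval σ (σ 4)) (g.eval σ (σ 4)) ∧
        Agree τ σ ∧ τ 4 = σ 4 ∧ ∀ j < k, τ 5 j = σ 5 j := by
    intro h g op f hop hcost okg ih ig k σ
    obtain ⟨τ, t, hr, ht, hv, ha, h4, hj⟩ := ih k σ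
    obtain ⟨υ, u, hr', ht', hv', ha', h4', hj'⟩ := ig (k + 1) τ
    refine ⟨_, _, .seq hr (.seq hr' (.write ..)), ?_, ?_, ?_, ?_, ?_⟩
    · rw [ha 0 (by decide) (by decide)] at ht'
      simp only [hcost, tmp, Expr.cost]
      omega
    · simp only [hop, Expr.eval, tmp, Memory.write_same, hv', hj' k (by omega), hv, h4]
      rw [ha.eval okg]
    · exact (ha'.trans ha).of_write (.inr rfl) _ _
    · rw [Memory.write_of_ne _ (by decide), h4', h4]
    · intro j hjk
      rw [Memory.write_of_ne_cell _ (by simp only [Expr.eval]; omega), hj' j (by omega), hj j hjk]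
  induction h generalizing k σ with
  | lit n =>
    exact ⟨_, _, .write .., by simp [Term.time, Expr.cost], by simp [Expr.eval, Term.eval, Memory.write],
      (Agree.refl σ).of_write (.inr rfl) _ _, Memory.write_of_ne _ (by decide),
      fun j hj => Memory.write_of_ne_cell _ (by simp only [Expr.eval]; omega)⟩
  | var x =>
    exact ⟨_, _, .write .., by simp [Term.time, Expr.cost, vr], by simp [Expr.eval, Term.eval, Memory.write, vr],
      (Agree.refl σ).of_write (.inr rfl) _ _, Memory.write_of_ne _ (by decide),
      fun j hj => Memory.write_of_ne_cell _ (by simp only [Expr.eval]; omega)⟩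
  | rd a h ih =>
    simp only [Term.Ok, Term.reads, List.mem_cons, not_or] at ok
    obtain ⟨τ, t, hr, ht, hv, ha, h4, hj⟩ := ih ⟨ok.1.2, ok.2.2⟩ k σ
    refine ⟨_, _, .seq hr (.write ..), ?_, ?_, ?_, ?_, ?_⟩
    · simp only [Term.time, tmp, Expr.cost]
      omega
    · simp only [Expr.eval, tmp, Memory.write_same, hv, Term.eval]
      rw [ha a (Ne.symm ok.1.1) (Ne.symm ok.2.1)]
    · exact ha.of_write (.inr rfl) _ _
    · rw [Memory.write_of_ne _ (by decide), h4]
    · intro j hjk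
      rw [Memory.write_of_ne_cell _ (by simp only [Expr.eval]; omega), hj j hjk]
  | add h g ih ig =>
    simp only [Term.Ok, Term.reads, List.mem_append, not_or] at ok
    exact bin h g .add (· + ·) (fun _ _ _ => rfl) (fun _ _ => rfl) ⟨ok.1.2, ok.2.2⟩
      (ih ⟨ok.1.1, ok.2.1⟩) (ig ⟨ok.1.2, ok.2.2⟩) k σ
  | sub h g ih ig =>
    simp only [Term.Ok, Term.reads, List.mem_append, not_or] at ok
    exact bin h g .sub (· - ·) (fun _ _ _ => rfl) (fun _ _ => rfl) ⟨ok.1.2, ok.2.2⟩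
      (ih ⟨ok.1.1, ok.2.1⟩) (ig ⟨ok.1.2, ok.2.2⟩) k σ
  | sum x h ih =>
    simp only [Term.Ok, Term.reads, List.mem_cons, not_or] at ok
    have okh : h.Ok := ⟨ok.1.2, ok.2.2⟩
    -- Cell `k` accumulates the sum, `k + 1` counts, and `k + 2` saves the old value of the bound
    -- variable; the body works from `k + 3` on.
    let Inv : ℕ → Memory → Prop := fun j τ =>
      τ 5 k = ∑ i ∈ Finset.range j, h.eval σ (Function.update (σ 4) x i) ∧ τ 5 (k + 1) = j ∧
      τ 5 (k + 2) = σ 4 x ∧ Agree τ σ ∧ (∀ y, y ≠ x → τ 4 y = σ 4 y) ∧ ∀ j < k, τ 5 j = σ 5 j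
    have step : ∀ j < σ 0 0, ∀ τ, Inv j τ →
        (Expr.sub (.read 0 (.lit 0)) (tmp (k + 1))).eval τ ≠ 0 ∧
        ∃ υ t, Runs (.seq (.write 4 (.lit x) (tmp (k + 1))) <| .seq (h.comp (k + 3)) <|
          .seq (.write 5 (.lit k) (.add (tmp k) (tmp (k + 3))))
          (.write 5 (.lit (k + 1)) (.add (tmp (k + 1)) (.lit 1)))) τ υ t ∧
          t ≤ h.time (σ 0 0) + 17 ∧ Inv (j + 1) υ := by
      rintro j hj τ ⟨i1, i2, i3, i4, i5, i6⟩
      refine ⟨?_, ?_⟩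
      · simp only [Expr.eval, tmp, i2, i4 0 (by decide) (by decide)]
        omega
      · obtain ⟨υ, u, hr, ht, hv, ha, h4, hj'⟩ := ih okh (k + 3) (τ.write 4 x j)
        have hA : Agree (τ.write 4 x j) σ := i4.of_write (.inl rfl) _ _
        have hρ : (τ.write 4 x j) 4 = Function.update (σ 4) x j := by
          rw [Memory.write_array]
          funext y
          by_cases hy : y = x
          · simp [hy]
          · simp [hy, i5 y hy]
        have h5 : ∀ i < k + 3, υ 5 i = τ 5 i := fun i hi => by
          rw [hj' i hi, Memory.write_of_ne _ (by decide)]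
        refine ⟨_, _, .seq (.write ..) (.seq (by simpa only [Expr.eval, tmp, i2] using hr)
          (.seq (.write ..) (.write ..))), ?_, ?_, ?_, ?_, ?_, ?_, ?_⟩
        · rw [hA 0 (by decide) (by decide)] at ht
          simp only [tmp, Expr.cost]
          omega
        · simp only [Expr.eval, tmp]
          rw [Memory.write_of_ne_cell _ (by omega), Memory.write_same, h5 k (by omega), i1, hv, hρ,
            Finset.sum_range_succ, hA.eval okh]
        · simp only [Expr.eval, tmp]
          rw [Memory.write_same, Memory.write_of_ne_cell _ (by omega), h5 _ (by omega), i2]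
        · simp only [Expr.eval, tmp]
          rw [Memory.write_of_ne_cell _ (by omega), Memory.write_of_ne_cell _ (by omega),
            h5 _ (by omega), i3]
        · exact ((ha.trans hA).of_write (.inr rfl) _ _).of_write (.inr rfl) _ _
        · intro y hy
          rw [Memory.write_of_ne _ (by decide), Memory.write_of_ne _ (by decide), h4, hρ,
            Function.update_of_ne hy]
        · intro i hi
          simp only [Expr.eval]
          rw [Memory.write_of_ne_cell _ (by omega), Memory.write_of_ne_cell _ (by omega),
            h5 _ (by omega), i6 i hi]
    obtain ⟨τ, t, hr, ht, i1, i2, i3, i4, i5, i6⟩ := exists_runs_loop (σ 0 0) _ Inv step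
      (fun τ hI => by
        obtain ⟨-, i2, -, i4, -, -⟩ := hI
        simp [Expr.eval, tmp, i2, i4 0 (by decide) (by decide)])
      (((σ.write 5 k 0).write 5 (k + 1) 0).write 5 (k + 2) (σ 4 x))
      (by
        refine ⟨?_, ?_, ?_, ?_, ?_, ?_⟩
        · simp [Memory.write]
        · simp [Memory.write]
        · simp [Memory.write]
        · exact (((Agree.refl σ).of_write (.inr rfl) _ _).of_write (.inr rfl) _ _).of_write
            (.inr rfl) _ _
        · intro y _
          simp [Memory.write]
        · intro j hj
          simp [Memory.write, show j ≠ k by omega, show j ≠ k + 1 by omega,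
            show j ≠ k + 2 by omega])
    refine ⟨_, _, .seq (.write ..) (.seq (.write ..) (.seq (.write ..) (.seq
      (by simpa [Expr.eval, vr, Memory.write] using hr) (.write ..)))), ?_, ?_, ?_, ?_, ?_⟩
    · simp only [tmp, vr, Expr.cost, Term.time] at ht ⊢
      have : σ 0 0 * (h.time (σ 0 0) + 17 + (1 + 1 + (1 + 1) + 1) + 1) =
        σ 0 0 * (h.time (σ 0 0) + 23) := by ring
      omega
    · rw [Memory.write_of_ne _ (by decide), i1]
      rfl
    · exact i4.of_write (.inl rfl) _ _
    · simp only [Expr.eval, tmp, i3]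
      rw [Memory.write_array]
      funext y
      by_cases hy : y = x
      · simp [hy]
      · simp [hy, i5 y hy]
    · intro j hj
      rw [Memory.write_of_ne _ (by decide), i6 j hj]

/-! ### Statements with bounded loops and their compilation -/

/-- Statements: assignments, sequences, and loops over the numbers below the content of cell `0` of
array `0`. -/
inductive Stmt : Type
  | assign (a : ℕ) (i h : Term) : Stmt
  | seq (p q : Stmt) : Stmt
  | each (x : ℕ) (p : Stmt) : Stmt

/-- Iteration of a family of maps. -/
def iterFrom {α : Type*} (f : ℕ → α → α) (σ : α) : ℕ → α
  | 0 => σ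
  | m + 1 => f m (iterFrom f σ m)

/-- The effect of a statement on the memory. -/
def Stmt.exec : Stmt → (ℕ → ℕ) → Memory → Memory
  | .assign a i h, ρ, σ => σ.write a (i.eval σ ρ) (h.eval σ ρ)
  | .seq p q, ρ, σ => q.exec ρ (p.exec ρ σ)
  | .each x p, ρ, σ => iterFrom (fun j τ => p.exec (Function.update ρ x j) τ) σ (σ 0 0)

/-- Statements that only write to arrays that are neither reserved nor hold the loop bound. -/
def Stmt.Ok : Stmt → Prop
  | .assign a i h => (a ≠ 0 ∧ a ≠ 4 ∧ a ≠ 5) ∧ i.Ok ∧ h.Ok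
  | .seq p q => p.Ok ∧ q.Ok
  | .each _ p => p.Ok

/-- The program of a statement; it changes no temporary cell below `k`. -/
def Stmt.comp : Stmt → ℕ → Prog
  | .assign a i h, k => .seq (i.comp k) (.seq (h.comp (k + 1)) (.write a (tmp k) (tmp (k + 1))))
  | .seq p q, k => .seq (p.comp k) (q.comp k)
  | .each x p, k =>
    .seq (.write 5 (.lit k) (.lit 0)) <| .seq (.write 5 (.lit (k + 1)) (vr x)) <|
    .seq (.loop (.sub (.read 0 (.lit 0)) (tmp k)) <|
      .seq (.write 4 (.lit x) (tmp k)) <| .seq (p.comp (k + 2))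
        (.write 5 (.lit k) (.add (tmp k) (.lit 1))))
    (.write 4 (.lit x) (tmp (k + 1)))

/-- A bound for the running time of the program of a statement. -/
def Stmt.time (n : ℕ) : Stmt → ℕ
  | .assign _ i h => i.time n + h.time n + 5
  | .seq p q => p.time n + q.time n
  | .each _ p => n * (p.time n + 16) + 18

theorem Agree.exec {p : Stmt} (ok : p.Ok) {σ τ : Memory} (H : Agree σ τ) (ρ : ℕ → ℕ) :
    Agree (p.exec ρ σ) (p.exec ρ τ) := by
  induction p generalizing σ τ ρ with
  | assign a i h =>
    intro a' h4 h5
    simp only [Stmt.exec, H.eval ok.2.1, H.eval ok.2.2]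
    funext j
    simp only [Memory.write, H a' h4 h5]
  | seq p q ihp ihq => exact ihq ok.2 (ihp ok.1 H ρ) ρ
  | each x p ih =>
    simp only [Stmt.exec, H 0 (by decide) (by decide)]
    generalize τ 0 0 = m
    induction m with
    | zero => exact H
    | succ m im => exact ih ok im _

theorem iterFrom_invariant {α β : Type*} {f : ℕ → α → α} {g : α → β}
    (h : ∀ j σ, g (f j σ) = g σ) (σ : α) (m : ℕ) : g (iterFrom f σ m) = g σ := by
  induction m with
  | zero => rfl
  | succ m ih => exact (h _ _).trans ih

theorem Stmt.exec_reserved {p : Stmt} (ok : p.Ok) (ρ : ℕ → ℕ) (σ : Memory) {a : ℕ}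
    (ha : a = 0 ∨ a = 4 ∨ a = 5) : p.exec ρ σ a = σ a := by
  induction p generalizing σ ρ with
  | assign b i h =>
    obtain ⟨⟨h0, h4, h5⟩, -⟩ := ok
    exact Memory.write_of_ne _ (by omega)
  | seq p q ihp ihq => exact (ihq ok.2 _ _).trans (ihp ok.1 _ _)
  | each x p ih => exact iterFrom_invariant (g := fun σ : Memory => σ a) (fun j τ => ih ok _ τ) _ _

/-- Semantics and machine are compared only up to `Agree`, because the compiled code uses the
reserved arrays as scratch space. The loop bound stays fixed since no admissible statement writes to
array `0`. -/
theorem Stmt.exists_runs_comp (p : Stmt) (ok : p.Ok) (k : ℕ) (σ : Memory) :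
    ∃ τ t, Runs (p.comp k) σ τ t ∧ t ≤ p.time (σ 0 0) ∧ Agree τ (p.exec (σ 4) σ) ∧ τ 4 = σ 4 ∧
      ∀ j < k, τ 5 j = σ 5 j := by
  induction p generalizing k σ with
  | assign a i h =>
    obtain ⟨τ, t, hr, ht, hv, ha, h4, hj⟩ := i.exists_runs_comp ok.2.1 k σ
    obtain ⟨υ, u, hr', ht', hv', ha', h4', hj'⟩ := h.exists_runs_comp ok.2.2 (k + 1) τ
    refine ⟨_, _, .seq hr (.seq hr' (.write ..)), ?_, ?_, ?_, ?_⟩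
    · rw [ha 0 (by decide) (by decide)] at ht'
      simp only [tmp, Expr.cost, Stmt.time]
      omega
    · intro b h4b h5b
      simp only [Expr.eval, tmp, hv', hj' k (by omega), hv, h4, ha.eval ok.2.2, Stmt.exec]
      funext j
      simp only [Memory.write, ha'.trans ha b h4b h5b]
    · rw [Memory.write_of_ne _ (Ne.symm ok.1.2.1), h4', h4]
    · intro j hjk
      rw [Memory.write_of_ne _ (Ne.symm ok.1.2.2), hj' j (by omega), hj j hjk]
  | seq p q ihp ihq =>
    obtain ⟨τ, t, hr, ht, ha, h4, hj⟩ := ihp ok.1 k σ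
    obtain ⟨υ, u, hr', ht', ha', h4', hj'⟩ := ihq ok.2 k τ
    refine ⟨_, _, .seq hr hr', ?_, ?_, h4'.trans h4, fun j h => (hj' j h).trans (hj j h)⟩
    · rw [ha 0 (by decide) (by decide), exec_reserved ok.1 _ _ (.inl rfl)] at ht'
      exact Nat.add_le_add ht ht'
    · rw [h4] at ha'
      exact ha'.trans (ha.exec ok.2 _)
  | each x p ih =>
    have ok : p.Ok := ok
    let f : ℕ → Memory → Memory := fun j τ => p.exec (Function.update (σ 4) x j) τ
    let Inv : ℕ → Memory → Prop := fun j τ =>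
      Agree τ (iterFrom f σ j) ∧ τ 5 k = j ∧ τ 5 (k + 1) = σ 4 x ∧
      (∀ y, y ≠ x → τ 4 y = σ 4 y) ∧ ∀ j < k, τ 5 j = σ 5 j
    have hf : ∀ j, iterFrom f σ j 0 = σ 0 := fun j =>
      iterFrom_invariant (g := fun σ : Memory => σ 0) (fun i τ => exec_reserved ok _ τ (.inl rfl)) σ j
    have step : ∀ j < σ 0 0, ∀ τ, Inv j τ →
        (Expr.sub (.read 0 (.lit 0)) (tmp k)).eval τ ≠ 0 ∧
        ∃ υ t, Runs (.seq (.write 4 (.lit x) (tmp k)) <| .seq (p.comp (k + 2))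
          (.write 5 (.lit k) (.add (tmp k) (.lit 1)))) τ υ t ∧
          t ≤ p.time (σ 0 0) + 10 ∧ Inv (j + 1) υ := by
      rintro j hj τ ⟨i1, i2, i3, i4, i5⟩
      refine ⟨?_, ?_⟩
      · simp only [Expr.eval, tmp, i2, i1 0 (by decide) (by decide), hf]
        omega
      · obtain ⟨υ, u, hr, ht, ha, h4, hj'⟩ := ih ok (k + 2) (τ.write 4 x j)
        have hA : Agree (τ.write 4 x j) (iterFrom f σ j) := i1.of_write (.inl rfl) _ _
        have hρ : (τ.write 4 x j) 4 = Function.update (σ 4) x j := by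
          rw [Memory.write_array]
          funext y
          by_cases hy : y = x
          · simp [hy]
          · simp [hy, i4 y hy]
        have h5 : ∀ i < k + 2, υ 5 i = τ 5 i := fun i hi => by
          rw [hj' i hi, Memory.write_of_ne _ (by decide)]
        refine ⟨_, _, .seq (.write ..) (.seq (by simpa only [Expr.eval, tmp, i2] using hr)
          (.write ..)), ?_, ?_, ?_, ?_, ?_, ?_⟩
        · rw [hA 0 (by decide) (by decide), hf] at ht
          simp only [tmp, Expr.cost]
          omega
        · rw [hρ] at ha
          exact (ha.trans (hA.exec ok _)).of_write (.inr rfl) _ _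
        · simp only [Expr.eval, tmp]
          rw [Memory.write_same, h5 _ (by omega), i2]
        · simp only [Expr.eval]
          rw [Memory.write_of_ne_cell _ (by omega), h5 _ (by omega), i3]
        · intro y hy
          rw [Memory.write_of_ne _ (by decide), h4, hρ, Function.update_of_ne hy]
        · intro i hi
          simp only [Expr.eval]
          rw [Memory.write_of_ne_cell _ (by omega), h5 _ (by omega), i5 i hi]
    obtain ⟨τ, t, hr, ht, i1, i2, i3, i4, i5⟩ := exists_runs_loop (σ 0 0) _ Inv step
      (fun τ hI => by
        obtain ⟨i1, i2, -⟩ := hI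
        simp [Expr.eval, tmp, i2, i1 0 (by decide) (by decide), hf])
      ((σ.write 5 k 0).write 5 (k + 1) (σ 4 x))
      (by
        refine ⟨?_, ?_, ?_, ?_, ?_⟩
        · exact ((Agree.refl σ).of_write (.inr rfl) _ _).of_write (.inr rfl) _ _
        · simp [Memory.write]
        · simp [Memory.write]
        · intro y _
          simp [Memory.write]
        · intro j hj
          simp [Memory.write, show j ≠ k by omega, show j ≠ k + 1 by omega])
    refine ⟨_, _, .seq (.write ..) (.seq (.write ..) (.seq
      (by simpa [Expr.eval, vr, Memory.write] using hr) (.write ..))), ?_, ?_, ?_, ?_⟩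
    · simp only [tmp, vr, Expr.cost, Stmt.time] at ht ⊢
      have : σ 0 0 * (p.time (σ 0 0) + 10 + (1 + 1 + (1 + 1) + 1) + 1) =
        σ 0 0 * (p.time (σ 0 0) + 16) := by ring
      omega
    · exact i1.of_write (.inl rfl) _ _
    · simp only [Expr.eval, tmp, i3]
      rw [Memory.write_array]
      funext y
      by_cases hy : y = x
      · simp [hy]
      · simp [hy, i4 y hy]
    · intro j hj
      rw [Memory.write_of_ne _ (by decide), i5 j hj]

/-! ### Polynomial bounds -/

/-- Functions that are bounded by a monomial. -/
def PolyBounded (f : ℕ → ℕ) : Prop := ∃ C d, ∀ n, 1 ≤ n → f n ≤ C * n ^ d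

theorem PolyBounded.const (c : ℕ) : PolyBounded fun _ => c :=
  ⟨c, 0, fun n _ => by simp⟩

theorem PolyBounded.id : PolyBounded fun n => n := ⟨1, 1, fun n _ => by simp⟩

/-- Both exponents are raised to `d + d'`, which is where `1 ≤ n` enters. -/
theorem PolyBounded.add {f g : ℕ → ℕ} (hf : PolyBounded f) (hg : PolyBounded g) :
    PolyBounded fun n => f n + g n := by
  obtain ⟨C, d, h⟩ := hf
  obtain ⟨C', d', h'⟩ := hg
  refine ⟨C + C', d + d', fun n hn => ?_⟩
  rw [Nat.add_mul]
  exact Nat.add_le_add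
    ((h n hn).trans (Nat.mul_le_mul_left _ (Nat.pow_le_pow_right hn (by omega))))
    ((h' n hn).trans (Nat.mul_le_mul_left _ (Nat.pow_le_pow_right hn (by omega))))

theorem PolyBounded.mul {f g : ℕ → ℕ} (hf : PolyBounded f) (hg : PolyBounded g) :
    PolyBounded fun n => f n * g n := by
  obtain ⟨C, d, h⟩ := hf
  obtain ⟨C', d', h'⟩ := hg
  refine ⟨C * C', d + d', fun n hn => (Nat.mul_le_mul (h n hn) (h' n hn)).trans_eq ?_⟩
  rw [pow_add]
  ring

theorem Term.polyBounded_time (h : Term) : PolyBounded h.time := by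
  induction h with
  | lit n => exact .const 3
  | var x => exact .const 4
  | rd a h ih => exact ih.add (.const 5)
  | add h g ih ig => exact (ih.add ig).add (.const 7)
  | sub h g ih ig => exact (ih.add ig).add (.const 7)
  | sum x h ih => exact (PolyBounded.id.mul (ih.add (.const 23))).add (.const 22)

theorem Stmt.polyBounded_time (p : Stmt) : PolyBounded p.time := by
  induction p with
  | assign a i h => exact (i.polyBounded_time.add h.polyBounded_time).add (.const 5)
  | seq p q ihp ihq => exact ihp.add ihq
  | each x p ih => exact (PolyBounded.id.mul (ih.add (.const 16))).add (.const 18)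

/-! ### Formulas -/

namespace Term

/-- The truth of a term that is read as a formula. -/
def Holds (σ : Memory) (ρ : ℕ → ℕ) (h : Term) : Prop := h.eval σ ρ ≠ 0

/-- Negation. -/
def neg (h : Term) : Term := .sub (.lit 1) h

/-- Disjunction. -/
def or (h g : Term) : Term := .add h g

/-- Conjunction. -/
def and (h g : Term) : Term := neg (or (neg h) (neg g))

/-- Existential quantification. -/
def ex (x : ℕ) (h : Term) : Term := .sum x h

/-- Universal quantification. -/
def all (x : ℕ) (h : Term) : Term := neg (ex x (neg h))

/-- Comparison. -/
def lt (h g : Term) : Term := .sub g h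

/-- Equality. -/
def eq (h g : Term) : Term := neg (or (lt h g) (lt g h))

variable {σ : Memory} {ρ : ℕ → ℕ}

@[simp] theorem holds_neg (h : Term) : Holds σ ρ (neg h) ↔ ¬ Holds σ ρ h := by
  simp only [Holds, neg, eval]
  omega

@[simp] theorem holds_or (h g : Term) : Holds σ ρ (or h g) ↔ Holds σ ρ h ∨ Holds σ ρ g := by
  simp only [Holds, or, eval]
  omega

@[simp] theorem holds_and (h g : Term) : Holds σ ρ (and h g) ↔ Holds σ ρ h ∧ Holds σ ρ g := by
  simp only [and, holds_neg, holds_or]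
  tauto

theorem holds_ex (x : ℕ) (h : Term) :
    Holds σ ρ (ex x h) ↔ ∃ j < σ 0 0, Holds σ (Function.update ρ x j) h := by
  simp [Holds, ex, eval]

theorem holds_ex_fin {n : ℕ} (hn : σ 0 0 = n) (x : ℕ) (h : Term) :
    Holds σ ρ (ex x h) ↔ ∃ j : Fin n, Holds σ (Function.update ρ x j) h := by
  rw [holds_ex, hn, Fin.exists_iff]
  simp only [exists_prop]

theorem holds_all_fin {n : ℕ} (hn : σ 0 0 = n) (x : ℕ) (h : Term) :
    Holds σ ρ (all x h) ↔ ∀ j : Fin n, Holds σ (Function.update ρ x j) h := by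
  simp [all, holds_ex_fin hn]

@[simp] theorem holds_lt (h g : Term) : Holds σ ρ (lt h g) ↔ h.eval σ ρ < g.eval σ ρ := by
  simp only [Holds, lt, eval]
  omega

@[simp] theorem holds_eq (h g : Term) : Holds σ ρ (eq h g) ↔ h.eval σ ρ = g.eval σ ρ := by
  simp only [eq, holds_neg, holds_or, holds_lt]
  omega

end Term

/-! ### Tables -/

/-- The number with the given digits in base `n`, the last digit first. -/
def digits (n : ℕ) : List ℕ → ℕ
  | [] => 0
  | x :: l => digits n l * n + x

/-- The remainder modulo `n` recovers the head, and cancelling it leaves the tail. This keeps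
distinct table entries in distinct cells. -/
theorem digits_inj {n : ℕ} {l m : List ℕ} (hlen : l.length = m.length) (hl : ∀ x ∈ l, x < n)
    (hm : ∀ x ∈ m, x < n) (h : digits n l = digits n m) : l = m := by
  induction l generalizing m with
  | nil => exact (List.length_eq_zero_iff.1 hlen.symm).symm
  | cons x l ih =>
    obtain _ | ⟨y, m⟩ := m
    · simp at hlen
    simp only [List.mem_cons, forall_eq_or_imp, List.length_cons, digits] at *
    have hx : x = y := by
      have := congrArg (· % n) h
      simpa [Nat.mod_eq_of_lt hl.1, Nat.mod_eq_of_lt hm.1] using this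
    subst hx
    have : digits n l = digits n m :=
      Nat.eq_of_mul_eq_mul_right (by omega : 0 < n) (Nat.add_right_cancel h)
    rw [ih (by omega) hl.2 hm.2 this]

namespace Term

/-- The index of a cell of a table whose coordinates are variables. The variable `100` is reserved
for multiplications by the loop bound. -/
def index : List ℕ → Term
  | [] => .lit 0
  | x :: l => .add (.sum 100 (index l)) (.var x)

theorem eval_index {σ : Memory} {ρ : ℕ → ℕ} {l : List ℕ} (h : 100 ∉ l) :
    (index l).eval σ ρ = digits (σ 0 0) (l.map ρ) := by
  induction l generalizing ρ with
  | nil => rfl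
  | cons x l ih =>
    simp only [List.mem_cons, not_or] at h
    have : ∀ j, (l.map (Function.update ρ 100 j)) = l.map ρ := fun j =>
      List.map_congr_left fun y hy => Function.update_of_ne (fun e => h.2 (by rwa [e] at hy)) _ _
    simp only [index, eval, ih h.2, this, Finset.sum_const, Finset.card_range, smul_eq_mul,
      List.map_cons, digits, mul_comm]

theorem reads_index {l : List ℕ} {a : ℕ} (h : a ∈ (index l).reads) : a = 0 := by
  induction l with
  | nil => simp [index, reads] at h
  | cons x l ih =>
    simp only [index, reads, List.append_nil, List.mem_cons] at h
    exact h.elim id ih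

/-- The content of a cell of a table. -/
def cell (a : ℕ) (l : List ℕ) : Term := .rd a (index l)

theorem holds_cell {σ : Memory} {ρ : ℕ → ℕ} {a : ℕ} {l : List ℕ} (h : 100 ∉ l) :
    Holds σ ρ (cell a l) ↔ σ a (digits (σ 0 0) (l.map ρ)) ≠ 0 := by
  rw [Holds, cell, eval, eval_index h]

end Term

/-- Loops over the variables of a list. -/
def Stmt.eachOf : List ℕ → Stmt → Stmt
  | [], p => p
  | x :: l, p => .each x (eachOf l p)

/-- Fill a table: write the value of `h` to each cell whose coordinates are the variables `l`. -/
def Stmt.fill (a : ℕ) (l : List ℕ) (h : Term) : Stmt := .eachOf l (.assign a (Term.index l) h)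

theorem Stmt.ok_eachOf {l : List ℕ} {p : Stmt} (h : p.Ok) : (Stmt.eachOf l p).Ok := by
  induction l with
  | nil => exact h
  | cons x l ih => exact ih

theorem Stmt.ok_fill {a : ℕ} {l : List ℕ} {h : Term} (ha : a ≠ 0 ∧ a ≠ 4 ∧ a ≠ 5) (hh : h.Ok) :
    (Stmt.fill a l h).Ok :=
  ok_eachOf ⟨ha, ⟨fun h => absurd (Term.reads_index h) (by decide),
    fun h => absurd (Term.reads_index h) (by decide)⟩, hh⟩

/-- Induction on the loop variables, with `L` fixed and the variables outside `l` frozen by `ρ`. The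
last clause, that other cells are untouched, makes the induction work: later rounds must not destroy
earlier entries. -/
theorem Stmt.exec_eachOf_assign {a n : ℕ} (ha : a ≠ 0) {L : List ℕ} (hL : 100 ∉ L) {h : Term}
    (hh : a ∉ h.reads) (l : List ℕ) (hsub : l ⊆ L) (hnd : l.Nodup) (ρ : ℕ → ℕ) (σ : Memory)
    (hn : σ 0 0 = n) :
    (∀ b, b ≠ a → (Stmt.eachOf l (.assign a (Term.index L) h)).exec ρ σ b = σ b) ∧
    (∀ ρ', (∀ x, x ∉ l → ρ' x = ρ x) → (∀ x ∈ L, ρ' x < n) →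
      (Stmt.eachOf l (.assign a (Term.index L) h)).exec ρ σ a (digits n (L.map ρ')) =
        h.eval σ ρ') ∧
    (∀ q, (∀ ρ', (∀ x, x ∉ l → ρ' x = ρ x) → (∀ x ∈ l, ρ' x < n) → q ≠ digits n (L.map ρ')) →
      (Stmt.eachOf l (.assign a (Term.index L) h)).exec ρ σ a q = σ a q) := by
  induction l generalizing ρ σ with
  | nil =>
    simp only [eachOf, exec, Term.eval_index hL, hn]
    refine ⟨fun b hb => Memory.write_of_ne _ hb, fun ρ' h1 _ => ?_, fun q hq => ?_⟩
    · obtain rfl : ρ' = ρ := funext fun x => h1 x (by simp)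
      exact Memory.write_same ..
    · exact Memory.write_of_ne_cell _ (hq ρ (fun _ _ => rfl) (by simp))
  | cons x l ih =>
    simp only [eachOf, exec, hn]
    set p := Stmt.eachOf l (.assign a (Term.index L) h) with hp
    have hx : x ∈ L := hsub List.mem_cons_self
    have hxl : x ∉ l := (List.nodup_cons.1 hnd).1
    have main : ∀ m ≤ n, ∀ τ, τ = iterFrom (fun j τ => p.exec (Function.update ρ x j) τ) σ m →
        (∀ b, b ≠ a → τ b = σ b) ∧
        (∀ ρ', (∀ y, y ∉ x :: l → ρ' y = ρ y) → (∀ x ∈ L, ρ' x < n) → ρ' x < m →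
          τ a (digits n (L.map ρ')) = h.eval σ ρ') ∧
        (∀ q, (∀ ρ', (∀ y, y ∉ x :: l → ρ' y = ρ y) → (∀ y ∈ l, ρ' y < n) → ρ' x < m →
          q ≠ digits n (L.map ρ')) → τ a q = σ a q) := by
      intro m
      induction m with
      | zero =>
        rintro - τ rfl
        exact ⟨fun _ _ => rfl, fun ρ' _ _ h => absurd h (by omega), fun _ _ => rfl⟩
      | succ m im =>
        rintro hm τ rfl
        obtain ⟨j1, j2, j3⟩ := im (by omega) _ rfl
        simp only [iterFrom]
        set τ := iterFrom (fun j τ => p.exec (Function.update ρ x j) τ) σ m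
        obtain ⟨i1, i2, i3⟩ := ih (fun y hy => hsub (List.mem_cons_of_mem _ hy))
          (List.nodup_cons.1 hnd).2 (Function.update ρ x m) τ (by rw [j1 0 ha.symm, hn])
        have agree : ∀ ρ' : ℕ → ℕ, (∀ y, y ∉ x :: l → ρ' y = ρ y) → ρ' x = m →
            ∀ y, y ∉ l → ρ' y = Function.update ρ x m y := by
          intro ρ' h1 h2 y hy
          by_cases hyx : y = x
          · simp [hyx, h2]
          · rw [Function.update_of_ne hyx]
            exact h1 y (by simp [hyx, hy])
        refine ⟨fun b hb => (i1 b hb).trans (j1 b hb), fun ρ' h1 h2 h3 => ?_, fun q hq => ?_⟩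
        · by_cases hxm : ρ' x = m
          · rw [i2 ρ' (agree ρ' h1 hxm) h2]
            exact h.eval_congr _ fun b hb => j1 b fun e => hh (e ▸ hb)
          -- This entry was filled in an earlier round. The current round writes only indices with
          -- value `m` at coordinate `x`, which are different by `digits_inj`.
          · rw [i3, j2 ρ' h1 h2 (by omega)]
            intro ρ'' h4 h5 he
            have hx'' : ρ'' x = m := by simpa using h4 x hxl
            refine hxm ((List.map_eq_map_iff.1 (digits_inj (by simp) ?_ ?_ he) x hx).trans hx'')
            · simpa using h2
            · simp only [List.mem_map, forall_exists_index, and_imp, forall_apply_eq_imp_iff₂]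
              intro y hy
              by_cases hyl : y ∈ l
              · exact h5 y hyl
              by_cases hyx : y = x
              · rw [hyx, hx'']
                omega
              · rw [h4 y hyl, Function.update_of_ne hyx, ← h1 y (by simp [hyx, hyl])]
                exact h2 y hy
        · rw [i3, j3]
          · exact fun ρ' h1 h2 h3 => hq ρ' h1 h2 (by omega)
          · intro ρ' h1 h2
            have hxm : ρ' x = m := by simpa using h1 x hxl
            refine hq ρ' (fun y hy => ?_) h2 (by omega)
            simp only [List.mem_cons, not_or] at hy
            rw [h1 y hy.2, Function.update_of_ne hy.1]
    obtain ⟨j1, j2, j3⟩ := main n le_rfl _ rfl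
    exact ⟨j1, fun ρ' h1 h2 => j2 ρ' h1 h2 (h2 x hx), fun q hq =>
      j3 q fun ρ' h1 h2 h3 => hq ρ' h1 (by simpa [h3] using h2)⟩

/-- The assignment of the variables with the values `f` of the first variables. -/
def withVars {m n : ℕ} (ρ : ℕ → ℕ) (f : Fin m → Fin n) : ℕ → ℕ :=
  fun x => if h : x < m then (f ⟨x, h⟩ : ℕ) else ρ x

/-- The array `a` is the table of the relation `P`. -/
def IsTable {m n : ℕ} (σ : Memory) (a : ℕ) (P : (Fin m → Fin n) → Prop) : Prop :=
  ∀ f : Fin m → Fin n, σ a (digits n (List.ofFn fun i => (f i : ℕ))) ≠ 0 ↔ P f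

theorem map_range_withVars {m n : ℕ} (ρ : ℕ → ℕ) (f : Fin m → Fin n) :
    (List.range m).map (withVars ρ f) = List.ofFn fun i => (f i : ℕ) := by
  apply List.ext_getElem
  · simp
  · intro i h1 h2
    simp only [List.length_map, List.length_range] at h1
    simp [withVars, h1]

theorem Stmt.exec_fill {m n a : ℕ} (ha : a ≠ 0) (hm : m ≤ 100) {h : Term} (hh : a ∉ h.reads)
    (ρ : ℕ → ℕ) {σ : Memory} (hn : σ 0 0 = n) :
    (∀ b, b ≠ a → (Stmt.fill a (List.range m) h).exec ρ σ b = σ b) ∧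
      IsTable ((Stmt.fill a (List.range m) h).exec ρ σ) a
        fun f : Fin m → Fin n => h.Holds σ (withVars ρ f) := by
  have hL : 100 ∉ List.range m := by simpa using hm
  obtain ⟨h1, h2, -⟩ := exec_eachOf_assign ha hL hh (List.range m) (fun _ h => h)
    List.nodup_range ρ σ hn
  refine ⟨h1, fun f => ?_⟩
  rw [← map_range_withVars ρ f, fill, h2]
  · rfl
  · intro x hx
    simp only [List.mem_range] at hx
    simp [withVars, hx]
  · intro x hx
    simp only [List.mem_range] at hx
    simp [withVars, hx]

/-- Iterate, as often as the loop bound says, the replacement of the table `a` by the table of `h`;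
the array `b` is used for intermediate results. -/
def Stmt.iterate (a b m : ℕ) (h : Term) : Stmt :=
  .each 101 (.seq (.fill b (List.range m) h) (.fill a (List.range m) (.cell b (List.range m))))

theorem Stmt.ok_iterate {a b m : ℕ} {h : Term} (ha : a ≠ 0 ∧ a ≠ 4 ∧ a ≠ 5)
    (hb : b ≠ 0 ∧ b ≠ 4 ∧ b ≠ 5) (hh : h.Ok) : (Stmt.iterate a b m h).Ok := by
  refine ⟨ok_fill hb hh, ok_fill ha ⟨?_, ?_⟩⟩ <;>
  · simp only [Term.cell, Term.reads, List.mem_cons, not_or]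
    exact ⟨by omega, fun h => absurd (Term.reads_index h) (by decide)⟩

/-- Filling `b` first makes the update simultaneous, as every entry is computed from the complete
old table. `hF` is asked of all memories that differ from `σ` only in `a` and `b`, since these occur
during the rounds. -/
theorem Stmt.exec_iterate {m n a b : ℕ} (ha : a ≠ 0) (hb : b ≠ 0) (hab : a ≠ b) (hm : m ≤ 100)
    {h : Term} (hh : b ∉ h.reads) (ρ : ℕ → ℕ) {σ : Memory} (hn : σ 0 0 = n)
    {P : (Fin m → Fin n) → Prop} (hP : IsTable σ a P)
    (F : ((Fin m → Fin n) → Prop) → (Fin m → Fin n) → Prop)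
    (hF : ∀ ρ τ P, (∀ c, c ≠ a → c ≠ b → τ c = σ c) → IsTable τ a P →
      ∀ f, h.Holds τ (withVars ρ f) ↔ F P f) :
    (∀ c, c ≠ a → c ≠ b → (Stmt.iterate a b m h).exec ρ σ c = σ c) ∧
      IsTable ((Stmt.iterate a b m h).exec ρ σ) a (F^[n] P) := by
  simp only [iterate, exec, hn]
  set body : ℕ → Memory → Memory := fun j τ =>
    (fill a (List.range m) (.cell b (List.range m))).exec (Function.update ρ 101 j)
      ((fill b (List.range m) h).exec (Function.update ρ 101 j) τ)
  suffices H : ∀ k, (∀ c, c ≠ a → c ≠ b → iterFrom body σ k c = σ c) ∧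
      IsTable (iterFrom body σ k) a (F^[k] P) from H n
  intro k
  induction k with
  | zero => exact ⟨fun _ _ _ => rfl, hP⟩
  | succ k ih =>
    obtain ⟨i1, i2⟩ := ih
    simp only [iterFrom, Function.iterate_succ_apply']
    set τ := iterFrom body σ k
    simp only [body]
    set ρ' := Function.update ρ 101 k
    obtain ⟨j1, j2⟩ := exec_fill (m := m) hb hm hh ρ' (σ := τ) (n := n)
      (by rw [i1 0 ha.symm hb.symm, hn])
    set υ := (Stmt.fill b (List.range m) h).exec ρ' τ
    have hυ : υ 0 0 = n := by rw [j1 0 hb.symm, i1 0 ha.symm hb.symm, hn]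
    have hL : 100 ∉ List.range m := by simpa using hm
    obtain ⟨k1, k2⟩ := exec_fill (m := m) (h := .cell b (List.range m)) ha hm (by
      simp only [Term.cell, Term.reads, List.mem_cons, not_or]
      exact ⟨hab, fun h => ha (Term.reads_index h)⟩) ρ' hυ
    refine ⟨fun c hca hcb => by rw [k1 c hca, j1 c hcb, i1 c hca hcb], fun f => ?_⟩
    refine (k2 f).trans ?_
    beta_reduce
    rw [Term.holds_cell hL, map_range_withVars, hυ, j2 f]
    exact hF _ _ _ i1 i2 f

/-! ### Reachability by iteration -/

/-- Until it becomes stationary, the increasing sequence gains an element in each round. -/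
theorem iterate_fixed_of_card_le {α : Type*} [Fintype α] (f : Finset α → Finset α)
    (hf : ∀ S, S ⊆ f S) (S : Finset α) {n : ℕ} (hn : Fintype.card α ≤ n) :
    f (f^[n] S) = f^[n] S := by
  have key : ∀ r, f (f^[r] S) = f^[r] S ∨ r ≤ (f^[r] S).card := by
    intro r
    induction r with
    | zero => exact .inr (Nat.zero_le _)
    | succ r ih =>
      simp only [Function.iterate_succ_apply']
      by_cases h : f (f^[r] S) = f^[r] S
      · exact .inl (by rw [h, h])
      · right
        have := Finset.card_lt_card ((hf _).ssubset_of_ne (Ne.symm h))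
        have := ih.resolve_left h
        omega
  obtain h | h := key n
  · exact h
  · have : f^[n] S = Finset.univ :=
      Finset.eq_univ_of_card _ (le_antisymm (Finset.card_le_univ _) (hn.trans h))
    rw [this]
    exact le_antisymm (Finset.subset_univ _) (hf _)

/-- After `n` rounds the set is a fixed point, hence closed under `E`. -/
theorem iterate_reach_iff {n : ℕ} (I : Fin n → Prop) (E : Fin n → Fin n → Prop) (a : Fin n) :
    (fun (Q : Fin n → Prop) b => Q b ∨ ∃ w, Q w ∧ E w b)^[n] I a ↔
      ∃ u, I u ∧ Relation.ReflTransGen E u a := by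
  classical
  set F : (Fin n → Prop) → Fin n → Prop := fun Q b => Q b ∨ ∃ w, Q w ∧ E w b with hF
  let g : Finset (Fin n) → Finset (Fin n) := fun S => Finset.univ.filter (F (· ∈ S))
  have hg : ∀ r b, F^[r] I b ↔ b ∈ g^[r] (Finset.univ.filter I) := by
    intro r
    induction r with
    | zero => simp
    | succ r ih =>
      intro b
      simp only [Function.iterate_succ_apply', g, Finset.mem_filter, Finset.mem_univ, true_and]
      rw [funext fun b => propext (ih b)]
  have hfix := iterate_fixed_of_card_le g
    (fun S b hb => Finset.mem_filter.2 ⟨Finset.mem_univ _, .inl hb⟩) (Finset.univ.filter I)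
    (n := n) (by simp)
  constructor
  · suffices H : ∀ r a, F^[r] I a → ∃ u, I u ∧ Relation.ReflTransGen E u a from H n a
    intro r
    induction r with
    | zero => exact fun a ha => ⟨a, ha, .refl⟩
    | succ r ih =>
      intro a ha
      rw [Function.iterate_succ_apply'] at ha
      obtain ha | ⟨w, hw, hwa⟩ := ha
      · exact ih a ha
      · obtain ⟨u, hu, huw⟩ := ih w hw
        exact ⟨u, hu, huw.tail hwa⟩
  · rintro ⟨u, hu, hua⟩
    have base : ∀ r, F^[r] I u := by
      intro r
      induction r with
      | zero => exact hu
      | succ r ih =>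
        rw [Function.iterate_succ_apply']
        exact .inl ih
    induction hua with
    | refl => exact base n
    | tail _ hwa ih =>
      rw [hg, ← hfix]
      exact Finset.mem_filter.2 ⟨Finset.mem_univ _, .inr ⟨_, (hg _ _).1 ih, hwa⟩⟩

/-! ### Domination in graphs without asteroidal triples -/

section Domination

variable {V : Type*}

/-- `b` can be reached from `a` by a walk that avoids the closed neighborhood of `v`. -/
inductive Avoid (nr : V → V → Prop) (v a : V) : V → Prop
  | refl : ¬ nr v a → Avoid nr v a a
  | tail {b d : V} : Avoid nr v a b → nr b d → ¬ nr v d → Avoid nr v a d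

variable {nr : V → V → Prop}

theorem Avoid.right {v a b : V} (h : Avoid nr v a b) : ¬ nr v b := by
  cases h <;> assumption

theorem Avoid.left {v a b : V} (h : Avoid nr v a b) : ¬ nr v a := by
  induction h <;> assumption

theorem Avoid.trans {v a b d : V} (h : Avoid nr v a b) (k : Avoid nr v b d) : Avoid nr v a d := by
  induction k with
  | refl _ => exact h
  | tail _ h1 h2 ih => exact ih.tail h1 h2

theorem Avoid.symm (symm : ∀ a b, nr a b → nr b a) {v a b : V} (h : Avoid nr v a b) :
    Avoid nr v b a := by
  induction h with
  | refl h => exact .refl h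
  | tail h1 h2 h3 ih => exact ((Avoid.refl h3).tail (symm _ _ h2) h1.right).trans ih

/-- A walk that avoids the neighborhood of `w` also avoids the neighborhood of `v`, or it has a
beginning that leads to `v`. -/
theorem Avoid.avoid_or {w a b v : V} (symm : ∀ a b, nr a b → nr b a) (h : Avoid nr w a b)
    (hv : ¬ nr w v) : Avoid nr v a b ∨ Avoid nr w a v := by
  induction h with
  | refl h =>
    by_cases k : nr v a
    · exact .inr ((Avoid.refl h).tail (symm _ _ k) hv)
    · exact .inl (.refl k)
  | @tail b d h1 h2 h3 ih =>
    by_cases k : nr v d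
    · exact .inr ((h1.tail h2 h3).tail (symm _ _ k) hv)
    · exact ih.imp_left fun h => h.tail h2 k

/-- A reflexive symmetric relation of nearness without asteroidal triples, with a coloring such
that near vertices of the same color are twins. -/
structure IsTame {K : Type*} (nr : V → V → Prop) (c : V → K) : Prop where
  refl : ∀ a, nr a a
  symm : ∀ a b, nr a b → nr b a
  twin : ∀ a b, nr a b → c a = c b → ∀ v, nr v a → nr v b
  no_triple : ∀ a b d, Avoid nr a b d → Avoid nr b a d → Avoid nr d a b → False

variable {K : Type*} {c : V → K}

theorem IsTame.no_triple_source (H : IsTame nr c) (s : V) {a b d : V} (ab : Avoid nr a s b) (ad : Avoid nr a s d)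
    (ba : Avoid nr b s a) (bd : Avoid nr b s d) (da : Avoid nr d s a) (db : Avoid nr d s b) :
    False :=
  H.no_triple a b d ((ab.symm H.symm).trans ad) ((ba.symm H.symm).trans bd)
    ((da.symm H.symm).trans db)

/-- Twins have the same closed neighborhood, so the same walk serves. -/
theorem IsTame.avoid_twin (H : IsTame nr c) (s : V) {a b d : V} (hab : nr a b) (hc : c a = c b) (h : Avoid nr a s d) :
    Avoid nr b s d := by
  have key : ∀ v, ¬ nr a v → ¬ nr b v := fun v hv hb =>
    hv (H.symm _ _ (H.twin b a (H.symm _ _ hab) hc.symm v (H.symm _ _ hb)))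
  induction h with
  | refl h => exact .refl (key _ h)
  | tail _ h2 h3 ih => exact ih.tail h2 (key _ h3)

open Classical in
/-- Two vertices suffice to dominate a set in which near vertices have the same color. -/
theorem IsTame.exists_cover (H : IsTame nr c) (s : V) (M : Set V) (hM : ∀ u ∈ M, ∀ v ∈ M, nr u v → c u = c v)
    (Y : Finset V) (hY : ∀ v ∈ M, ∃ x ∈ Y, ¬ Avoid nr v s x) :
    ∃ X ⊆ Y, X.card ≤ 2 ∧ ∀ v ∈ M, ∃ x ∈ X, ¬ Avoid nr v s x := by
  induction Y using Finset.strongInduction with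
  | H Y ih =>
    by_cases hcard : Y.card ≤ 2
    · exact ⟨Y, subset_rfl, hcard, hY⟩
    by_cases hred : ∃ y ∈ Y, ∀ v ∈ M, ∃ x ∈ Y.erase y, ¬ Avoid nr v s x
    · obtain ⟨y, hy, h⟩ := hred
      obtain ⟨X, hX, h1, h2⟩ := ih _ (Finset.erase_ssubset hy) h
      exact ⟨X, hX.trans (Finset.erase_subset _ _), h1, h2⟩
    exfalso
    -- In an irredundant cover each `a` has a private vertex `p a`, dominated on the way to `a` but
    -- not on the way to any other member.
    push Not at hred
    choose! p hpM hp using hred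
    obtain ⟨x, y, z, hx, hy, hz, hxy, hxz, hyz⟩ := Finset.two_lt_card_iff.1 (not_le.1 hcard)
    have own : ∀ a ∈ Y, ¬ Avoid nr (p a) s a := fun a ha h => by
      obtain ⟨b, hb, hn⟩ := hY (p a) (hpM a ha)
      by_cases hba : b = a
      · exact hn (hba ▸ h)
      · exact hn (hp a ha b (Finset.mem_erase.2 ⟨hba, hb⟩))
    have other : ∀ a ∈ Y, ∀ b ∈ Y, a ≠ b → Avoid nr (p a) s b := fun a ha b hb hab =>
      hp a ha b (Finset.mem_erase.2 ⟨hab.symm, hb⟩)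
    have un : ∀ a ∈ Y, ∀ b ∈ Y, a ≠ b → Avoid nr (p a) s (p b) := by
      intro a ha b hb hab
      -- Near private vertices would have equal color, hence be twins, and `p a` is not dominated on
      -- the way to `b`.
      have hn : ¬ nr (p a) (p b) := fun hn =>
        own b hb (H.avoid_twin s hn (hM _ (hpM a ha) _ (hpM b hb) hn) (other a ha b hb hab))
      -- The walk from `s` to `b` that avoids `p a` must meet the neighborhood of `p b`, so its
      -- beginning can be diverted to `p b`. Three private vertices thus form an asteroidal triple.
      exact ((other a ha b hb hab).avoid_or H.symm hn).resolve_left (own b hb)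
    exact H.no_triple_source s (un x hx y hy hxy) (un x hx z hz hxz) (un y hy x hx hxy.symm)
      (un y hy z hz hyz) (un z hz x hx hxz.symm) (un z hz y hy hyz.symm)

/-! ### A preorder on the vertices away from the source -/

open Classical in
/-- The number of vertices that `b` strictly surpasses as seen from `s`. -/
noncomputable def depth [Fintype V] (nr : V → V → Prop) (s b : V) : ℕ :=
  (Finset.univ.filter fun a => ¬ Avoid nr a s b ∧ Avoid nr b s a).card

/-- Strict surpassing is transitive by `Avoid.avoid_or`, so the set counted for `a` is contained in
that for `b`, and `a` itself is only in the latter. -/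
theorem IsTame.depth_lt [Fintype V] (H : IsTame nr c) {s a b : V} (h1 : ¬ Avoid nr a s b)
    (h2 : Avoid nr b s a) : depth nr s a < depth nr s b := by
  classical
  refine Finset.card_lt_card (Finset.ssubset_iff_of_subset ?_ |>.2 ⟨a, ?_, ?_⟩)
  · intro d hd
    simp only [Finset.mem_filter, Finset.mem_univ, true_and] at hd ⊢
    obtain ⟨h3, h4⟩ := hd
    constructor
    · intro h
      rcases h.avoid_or H.symm (v := a) (fun k => h4.right (H.symm _ _ k)) with h | h
      · exact h1 h
      · exact h3 h
    · refine (h2.avoid_or H.symm (v := d) fun k => h1 ?_).resolve_left h3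
      exact h4.tail (H.symm _ _ k) fun k => h2.right (H.symm _ _ k)
  · simpa using ⟨h1, h2⟩
  · simp only [Finset.mem_filter, Finset.mem_univ, true_and, not_and]
    exact fun h k => h k

/-- All that lies on the same side of `s` as `x` is dominated on the way to all that lies on the
side of `y`. -/
def Absorbed (nr : V → V → Prop) (s x y : V) : Prop :=
  ∀ x' y', Avoid nr s x x' → Avoid nr s y y' → ¬ Avoid nr x' s y'

/-- A preorder on the vertices away from `s`; if `Below nr s x y`, then `x` is dominated on the way
to `y`. -/
def Below [Fintype V] (nr : V → V → Prop) (s x y : V) : Prop :=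
  ¬ nr s y ∧ (Absorbed nr s x y ∨ Avoid nr s x y ∧ depth nr s x ≤ depth nr s y)

theorem Below.refl [Fintype V] {s x : V} (h : ¬ nr s x) : Below nr s x x := ⟨h, .inr ⟨.refl h, le_rfl⟩⟩

theorem IsTame.below_trans [Fintype V] (H : IsTame nr c) {s x y z : V} (h : Below nr s x y)
    (k : Below nr s y z) : Below nr s x z := by
  refine ⟨k.1, ?_⟩
  obtain ⟨hy, h | ⟨h1, h2⟩⟩ := h <;> obtain ⟨hz, k | ⟨k1, k2⟩⟩ := k
  · left
    intro x' z' hx hz' hR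
    -- If `x'` is near `y`, it lies on the side of `y`. Otherwise the walk to `z'` either avoids `y`
    -- as well or can be diverted to `y`, and each is excluded.
    by_cases hn : nr x' y
    · exact k x' z' (((Avoid.refl hx.right).tail hn hy).symm H.symm) hz' hR
    · exact (hR.avoid_or H.symm hn).elim (k y z' (.refl hy) hz') (h x' y hx (.refl hy))
  · exact .inl fun x' z' hx hz' => h x' z' hx (k1.trans hz')
  · exact .inl fun x' z' hx hz' => k x' z' ((h1.symm H.symm).trans hx) hz'
  · exact .inr ⟨h1.trans k1, h2.trans k2⟩

/-- On a common side, walks from `s` to each of `x` and `y` avoiding the other would make `s, x, y`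
an asteroidal triple. If only `x` is avoided on the way to `y`, then `y` has smaller depth. -/
theorem IsTame.not_avoid_of_below [Fintype V] (H : IsTame nr c) {s x y : V} (hx : ¬ nr s x)
    (h : Below nr s x y) : ¬ Avoid nr x s y := by
  obtain ⟨hy, h | ⟨h1, h2⟩⟩ := h
  · exact h x y (.refl hx) (.refl hy)
  · intro hR
    by_cases hR' : Avoid nr y s x
    · exact H.no_triple s x y h1 hR hR'
    · exact absurd (H.depth_lt hR' hR) (by omega)

/-! ### Attachment of the sides to the source -/

/-- The vertices by which the side of `x` is attached to `s`. -/
def gates (nr : V → V → Prop) (s x : V) : Set V := {p | nr s p ∧ ∃ y, Avoid nr s x y ∧ nr p y}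

/-- A vertex `z` away from `s` that is near some vertex of the side would belong to that side. Hence
the walk may be continued freely inside it. -/
theorem IsTame.avoid_of_same_side (H : IsTame nr c) {s x y z : V} (hR : Avoid nr z s x)
    (hx : Avoid nr s x y) (hz : ¬ nr s z) (hxz : ¬ Avoid nr s x z) : Avoid nr z s y := by
  induction hx with
  | refl _ => exact hR
  | tail h1 h2 h3 ih =>
    exact ih.tail h2 fun hn => hxz ((h1.tail h2 h3).tail (H.symm _ _ hn) hz)

/-- A walk enters the side of `x` through a gate, and inside the side it cannot come near `z`. So
only the gate can be an obstacle. -/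
theorem IsTame.avoid_iff_gates (H : IsTame nr c) {s x z : V} (hx : ¬ nr s x) (hz : ¬ nr s z)
    (hxz : ¬ Avoid nr s x z) : Avoid nr z s x ↔ ∃ p ∈ gates nr s x, ¬ nr z p := by
  constructor
  · intro h
    suffices key : ∀ a, Avoid nr z s a → nr s a ∨ ∃ p ∈ gates nr s a, ¬ nr z p from
      (key x h).resolve_left hx
    intro a ha
    induction ha with
    | refl h => exact .inl (H.refl s)
    | @tail u w h1 h2 h3 ih =>
      by_cases hw : nr s w
      · exact .inl hw
      right
      by_cases hu : nr s u
      · exact ⟨u, ⟨hu, w, .refl hw, h2⟩, h1.right⟩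
      · obtain ⟨p, ⟨hp, y, hy, hpy⟩, hzp⟩ := ih.resolve_left hu
        exact ⟨p, ⟨hp, y, ((Avoid.refl hw).tail (H.symm _ _ h2) hu).trans hy, hpy⟩, hzp⟩
  · rintro ⟨p, ⟨hp, y, hy, hpy⟩, hzp⟩
    have hsy : ¬ nr z y := fun hn => hxz (hy.tail (H.symm _ _ hn) hz)
    have h1 : Avoid nr z s y :=
      ((Avoid.refl fun h => hz (H.symm _ _ h)).tail hp hzp).tail hpy hsy
    exact H.avoid_of_same_side h1 (hy.symm H.symm) hz fun h => hxz (hy.trans h)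

/-- The side of `x` is attached to `s` at all places where those of `y` and `z` are, and these are
incomparable. -/
def Spans (nr : V → V → Prop) (s x y z : V) : Prop :=
  gates nr s y ⊆ gates nr s x ∧ gates nr s z ⊆ gates nr s x ∧ ¬ gates nr s y ⊆ gates nr s z ∧
    ¬ gates nr s z ⊆ gates nr s y

/-- Two vertices on different sides of `s` neither of which absorbs the other. -/
structure Unrelated (nr : V → V → Prop) (s x y : V) : Prop where
  left : ¬ nr s x
  right : ¬ nr s y
  side : ¬ Avoid nr s x y
  exists_left : ∃ x', Avoid nr s x x' ∧ Avoid nr x' s y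
  exists_right : ∃ y', Avoid nr s y y' ∧ Avoid nr y' s x

/-- Depths are always comparable, so incomparable vertices lie on different sides. Failure of
absorption then gives the two avoiding walks, moved within a side by `IsTame.avoid_of_same_side`. -/
theorem IsTame.unrelated [Fintype V] (H : IsTame nr c) {s x y : V} (hx : ¬ nr s x) (hy : ¬ nr s y)
    (h : ¬ Below nr s x y) (k : ¬ Below nr s y x) : Unrelated nr s x y := by
  simp only [Below, hx, hy, not_false_eq_true, true_and, not_or, not_and, not_le] at h k
  have hs : ¬ Avoid nr s x y := fun hxy =>
    absurd (h.2 hxy) (not_lt.2 (k.2 (hxy.symm H.symm)).le)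
  have key : ∀ x y, ¬ Avoid nr s x y → ¬ Absorbed nr s x y →
      ∃ x', Avoid nr s x x' ∧ Avoid nr x' s y := by
    intro x y hs h
    simp only [Absorbed, not_forall, not_not] at h
    obtain ⟨x', y', h1, h2, h3⟩ := h
    exact ⟨x', h1, H.avoid_of_same_side h3 (h2.symm H.symm) h1.right fun h =>
      hs (h1.trans ((h2.trans h).symm H.symm))⟩
  exact ⟨hx, hy, hs, key x y hs h.1, key y x (fun h => hs (h.symm H.symm)) k.1⟩

/-- Let `w` on the side of `x` be avoidable on the way to `y` but not to `z`. Then `w` is near all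
gates of `z`, making them gates of `x`, while it misses some gate of `y`, which is then no gate of
`z`. Exchanging `y` and `z` gives the rest of `Spans`. -/
theorem IsTame.spans_or (H : IsTame nr c) {s x y z : V} (hxy : Unrelated nr s x y)
    (hxz : Unrelated nr s x z) :
    Spans nr s x y z ∨ ∃ w, Avoid nr s x w ∧ Avoid nr w s y ∧ Avoid nr w s z := by
  by_contra! hcon
  obtain ⟨hcon, hw⟩ := hcon
  have sub : ∀ y z, Unrelated nr s x y → Unrelated nr s x z →
      (∀ w, Avoid nr s x w → Avoid nr w s y → ¬ Avoid nr w s z) →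
      gates nr s z ⊆ gates nr s x ∧ ¬ gates nr s y ⊆ gates nr s z := by
    intro y z hxy hxz hw
    obtain ⟨w, h1, h2⟩ := hxy.exists_left
    have h3 := hw w h1 h2
    have side : ∀ y, Unrelated nr s x y → ¬ Avoid nr s y w := fun y hy h =>
      hy.side (h1.trans (h.symm H.symm))
    rw [H.avoid_iff_gates hxz.right h1.right (side z hxz)] at h3
    rw [H.avoid_iff_gates hxy.right h1.right (side y hxy)] at h2
    push Not at h3
    obtain ⟨p, hp, hwp⟩ := h2
    exact ⟨fun q hq => ⟨hq.1, w, h1, H.symm _ _ (h3 q hq)⟩, fun h => hwp (h3 p (h hp))⟩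
  obtain ⟨h1, h2⟩ := sub y z hxy hxz hw
  obtain ⟨h3, h4⟩ := sub z y hxz hxy fun w h k l => hw w h l k
  exact hcon ⟨h3, h1, h2, h4⟩

theorem Unrelated.symm (H : IsTame nr c) {s x y : V} (h : Unrelated nr s x y) :
    Unrelated nr s y x :=
  ⟨h.right, h.left, fun k => h.side (k.symm H.symm), h.exists_right, h.exists_left⟩

/-- Otherwise each side contains a vertex avoidable on the way to both others, and these three form
an asteroidal triple. -/
theorem IsTame.exists_spans (H : IsTame nr c) {s x y z : V} (hxy : Unrelated nr s x y)
    (hxz : Unrelated nr s x z) (hyz : Unrelated nr s y z) :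
    Spans nr s x y z ∨ Spans nr s y x z ∨ Spans nr s z x y := by
  by_contra! hcon
  obtain ⟨x', x1, x2, x3⟩ := (H.spans_or hxy hxz).resolve_left hcon.1
  obtain ⟨y', y1, y2, y3⟩ := (H.spans_or (hxy.symm H) hyz).resolve_left hcon.2.1
  obtain ⟨z', z1, z2, z3⟩ := (H.spans_or (hxz.symm H) (hyz.symm H)).resolve_left hcon.2.2
  have move : ∀ {a a' b b'}, Unrelated nr s a b → Avoid nr s a a' → Avoid nr s b b' →
      Avoid nr a' s b → Avoid nr a' s b' := fun hab ha hb h =>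
    H.avoid_of_same_side h hb ha.right fun k => hab.side (ha.trans (k.symm H.symm))
  exact H.no_triple_source s (move hxy x1 y1 x2) (move hxz x1 z1 x3) (move (hxy.symm H) y1 x1 y2)
    (move hyz y1 z1 y3) (move (hxz.symm H) z1 x1 z2) (move (hyz.symm H) z1 y1 z3)

/-- This is pure set inclusion. If the gates of one side contain two incomparable gate sets, then
the fourth must contain the same two. The two containing sets and one of the contained sets then
violate `Spans`. -/
theorem IsTame.not_four_unrelated (H : IsTame nr c) {s w x y z : V} (hwx : Unrelated nr s w x)
    (hwy : Unrelated nr s w y) (hwz : Unrelated nr s w z) (hxy : Unrelated nr s x y)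
    (hxz : Unrelated nr s x z) (hyz : Unrelated nr s y z) : False := by
  have h1 := H.exists_spans hwx hwy hxy
  have h2 := H.exists_spans hwx hwz hxz
  have h3 := H.exists_spans hwy hwz hyz
  have h4 := H.exists_spans hxy hxz hyz
  simp only [Spans] at h1 h2 h3 h4
  have trans := fun {A B C : Set V} (h : A ⊆ B) (k : B ⊆ C) => h.trans k
  rcases h1 with ⟨_, _, _, _⟩ | ⟨_, _, _, _⟩ | ⟨_, _, _, _⟩ <;>
  rcases h2 with ⟨_, _, _, _⟩ | ⟨_, _, _, _⟩ | ⟨_, _, _, _⟩ <;>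
  tauto

open Classical in
/-- Three vertices suffice to dominate a set of vertices with respect to `Below`. -/
theorem IsTame.exists_below [Fintype V] (H : IsTame nr c) (s : V) (M : Set V) (Y : Finset V)
    (hY : ∀ v ∈ M, ∃ x ∈ Y, Below nr s v x) :
    ∃ X ⊆ Y, X.card ≤ 3 ∧ ∀ v ∈ M, ∃ x ∈ X, Below nr s v x := by
  induction Y using Finset.strongInduction with
  | H Y ih =>
    by_cases hred : ∃ y ∈ Y, ∀ v ∈ M, ∃ x ∈ Y.erase y, Below nr s v x
    · obtain ⟨y, hy, h⟩ := hred
      obtain ⟨X, hX, h1, h2⟩ := ih _ (Finset.erase_ssubset hy) h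
      exact ⟨X, hX.trans (Finset.erase_subset _ _), h1, h2⟩
    refine ⟨Y, subset_rfl, ?_, hY⟩
    by_contra hcard
    push Not at hred hcard
    choose! p hpM hp using hred
    have own : ∀ a ∈ Y, Below nr s (p a) a := fun a ha => by
      obtain ⟨b, hb, hn⟩ := hY (p a) (hpM a ha)
      by_cases hba : b = a
      · exact hba ▸ hn
      · exact absurd hn (hp a ha b (Finset.mem_erase.2 ⟨hba, hb⟩))
    -- By transitivity, `Below nr s a b` would make the private vertex of `a` lie below `b` too.
    have other : ∀ a ∈ Y, ∀ b ∈ Y, a ≠ b → ¬ Below nr s a b := fun a ha b hb hab h =>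
      hp a ha b (Finset.mem_erase.2 ⟨hab.symm, hb⟩) (H.below_trans (own a ha) h)
    have un : ∀ a ∈ Y, ∀ b ∈ Y, a ≠ b → Unrelated nr s a b := fun a ha b hb hab =>
      H.unrelated (own a ha).1 (own b hb).1 (other a ha b hb hab) (other b hb a ha hab.symm)
    obtain ⟨x, hx, hcard'⟩ : ∃ x ∈ Y, 2 < (Y.erase x).card := by
      obtain ⟨x, hx⟩ := Finset.card_pos.1 (by omega : 0 < Y.card)
      exact ⟨x, hx, by rw [Finset.card_erase_of_mem hx]; omega⟩
    obtain ⟨y, z, w, hy, hz, hw, hyz, hyw, hzw⟩ := Finset.two_lt_card_iff.1 hcard'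
    simp only [Finset.mem_erase] at hy hz hw
    exact H.not_four_unrelated (un x hx y hy.2 hy.1.symm) (un x hx z hz.2 hz.1.symm)
      (un x hx w hw.2 hw.1.symm) (un y hy.2 z hz.2 hyz) (un y hy.2 w hw.2 hyw)
      (un z hz.2 w hw.2 hzw)

end Domination

/-! ### The game on a tame nearness relation -/

section Game

variable {V K : Type*} {nr : V → V → Prop} {c : V → K} {s : V}

/-- The territory after color `i` is called. -/
def expand (nr : V → V → Prop) (c : V → K) (T : Set V) (i : K) : Set V :=
  T ∪ {v | c v = i ∧ ∃ u ∈ T, nr u v}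

/-- The territory after the colors of a list are called. -/
def run (nr : V → V → Prop) (c : V → K) (T : Set V) (γ : List K) : Set V :=
  γ.foldl (expand nr c) T

theorem subset_expand (T : Set V) (i : K) : T ⊆ expand nr c T i := Set.subset_union_left

theorem subset_run (T : Set V) (γ : List K) : T ⊆ run nr c T γ := by
  induction γ generalizing T with
  | nil => exact subset_rfl
  | cons i γ ih => exact (subset_expand T i).trans (ih _)

/-! ### Connected territories and winning states -/

/-- A set that contains `s` and in which each vertex can be reached from `s`. -/
def ConnectedFrom (nr : V → V → Prop) (s : V) (T : Set V) : Prop :=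
  s ∈ T ∧ ∀ x ∈ T, Relation.ReflTransGen (fun a b => nr a b ∧ b ∈ T) s x

theorem connectedFrom_expand {T : Set V} (h : ConnectedFrom nr s T) (i : K) :
    ConnectedFrom nr s (expand nr c T i) := by
  have key : ∀ x ∈ T, Relation.ReflTransGen (fun a b => nr a b ∧ b ∈ expand nr c T i) s x :=
    fun x hx => (h.2 x hx).lift id fun a b hab => ⟨hab.1, subset_expand T i hab.2⟩
  refine ⟨subset_expand T i h.1, fun x hx => ?_⟩
  obtain hxT | ⟨hc, u, hu, hn⟩ := id hx
  · exact key x hxT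
  · exact (key u hu).tail ⟨hn, hx⟩

/-- A connected set with no vertex near `v` would contain a walk from `s` to `x` avoiding the
neighborhood of `v`. -/
theorem ConnectedFrom.exists_near {T : Set V} (h : ConnectedFrom nr s T)
    (symm : ∀ a b, nr a b → nr b a) {x v : V} (hx : x ∈ T) (hv : ¬ Avoid nr v s x) :
    ∃ u ∈ T, nr u v := by
  by_contra! hcon
  refine hv ?_
  have := h.2 x hx
  clear hx hv
  induction this with
  | refl => exact .refl fun h' => hcon s h.1 (symm _ _ h')
  | tail _ h2 ih => exact ih.tail h2.1 fun h' => hcon _ h2.2 (symm _ _ h')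

/-- The vertex `v` is dominated by each connected set that contains `s` and the vertices `t`. -/
def Covered {ι : Type*} (nr : V → V → Prop) (s : V) (t : ι → V) (v : V) : Prop :=
  ∃ k, ¬ Avoid nr v s (t k)

/-- When color `i` is called by a player who owns `s` and the vertices `t`, he owns `t'`. -/
def Leads {ι : Type*} (nr : V → V → Prop) (c : V → K) (s : V) (t : ι → V) (i : K) (t' : ι → V) :
    Prop :=
  ∀ k, t' k = s ∨ (∃ l, t' k = t l) ∨ c (t' k) = i ∧ Covered nr s t (t' k)

/-- A player who owns `s` and the vertices `t` can dominate everything with `r` calls at most `e`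
of which are calls of a color that is not completely dominated. -/
def Wins {ι : Type*} (nr : V → V → Prop) (c : V → K) (s : V) : ℕ → ℕ → (ι → V) → Prop
  | 0, _, t => ∀ v, Covered nr s t v
  | r + 1, e, t => (∀ v, Covered nr s t v) ∨ ∃ u t', Leads nr c s t (c u) t' ∧
      ((∀ w, c w = c u → Covered nr s t w) ∧ Wins nr c s r e t' ∨
        ∃ e', e' + 1 = e ∧ Wins nr c s r e' t')

theorem Wins.mono_left {ι : Type*} {r r' e : ℕ} {t : ι → V} (h : Wins nr c s r e t)
    (hr : r ≤ r') : Wins nr c s r' e t := by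
  induction r' generalizing r e t with
  | zero => rwa [Nat.le_zero.1 hr] at h
  | succ r' ih =>
    obtain _ | r := r
    · exact .inl h
    · refine h.imp_right ?_
      rintro ⟨u, t', hl, ⟨h1, h2⟩ | ⟨e', he, h2⟩⟩
      · exact ⟨u, t', hl, .inl ⟨h1, ih h2 (by omega)⟩⟩
      · exact ⟨u, t', hl, .inr ⟨e', he, ih h2 (by omega)⟩⟩

theorem Wins.mono_right {ι : Type*} {r e e' : ℕ} {t : ι → V} (h : Wins nr c s r e t)
    (he : e ≤ e') : Wins nr c s r e' t := by
  induction r generalizing e e' t with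
  | zero => exact h
  | succ r ih =>
    refine h.imp_right ?_
    rintro ⟨u, t', hl, ⟨h1, h2⟩ | ⟨e₁, he₁, h2⟩⟩
    · exact ⟨u, t', hl, .inl ⟨h1, ih h2 he⟩⟩
    · exact ⟨u, t', hl, .inr ⟨e' - 1, by omega, ih h2 (by omega)⟩⟩

/-- The number of colors that occur outside of a set. -/
noncomputable def colorsLeft (c : V → K) (T : Set V) : ℕ := (c '' Tᶜ).ncard

theorem mem_run_of_mem {T : Set V} {γ : List K} {v : V} (hv : ∃ u ∈ T, nr u v) (hc : c v ∈ γ) :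
    v ∈ run nr c T γ := by
  induction γ generalizing T with
  | nil => simp at hc
  | cons i γ ih =>
    obtain ⟨u, hu, hn⟩ := hv
    obtain h | h := List.mem_cons.1 hc
    · exact subset_run _ γ (.inr ⟨h, u, hu, hn⟩)
    · exact ih ⟨u, subset_expand T i hu, hn⟩ h

/-- The owned vertices stay inside the real territory, which therefore dominates all that the state
dominates. A completely dominated color vanishes when called, and each other call is paid by `e`. -/
theorem Wins.exists_run [Finite V] {ι : Type*} [Nonempty ι] (symm : ∀ a b, nr a b → nr b a)
    {r e : ℕ} {t : ι → V} (h : Wins nr c s r e t) {T : Set V} (hT : ConnectedFrom nr s T)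
    (ht : ∀ k, t k ∈ T) : ∃ γ : List K, γ.length ≤ e + colorsLeft c T ∧
      run nr c T γ = Set.univ := by
  -- When everything is dominated, the remaining colors can be called once each in any order.
  have final : ∀ (t : ι → V) (T : Set V), ConnectedFrom nr s T → (∀ k, t k ∈ T) →
      (∀ v, Covered nr s t v) → ∃ γ : List K, γ.length ≤ colorsLeft c T ∧
      run nr c T γ = Set.univ := by
    intro t T hT ht h
    refine ⟨(Set.toFinite (c '' Tᶜ)).toFinset.toList, ?_, ?_⟩
    · rw [Finset.length_toList, colorsLeft, Set.ncard_eq_toFinset_card _ (Set.toFinite _)]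
    · refine Set.eq_univ_of_forall fun v => ?_
      by_cases hv : v ∈ T
      · exact subset_run _ _ hv
      · obtain ⟨k, hk⟩ := h v
        refine mem_run_of_mem (hT.exists_near symm (ht k) hk) ?_
        simpa using ⟨v, hv, rfl⟩
  induction r generalizing e t T with
  | zero =>
    obtain ⟨γ, h1, h2⟩ := final t T hT ht h
    exact ⟨γ, by omega, h2⟩
  | succ r ih =>
    obtain h | ⟨u, t', hl, h⟩ := h
    · obtain ⟨γ, h1, h2⟩ := final t T hT ht h
      exact ⟨γ, by omega, h2⟩
    have ht' : ∀ k, t' k ∈ expand nr c T (c u) := by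
      intro k
      obtain h | ⟨l, h⟩ | ⟨hc, l, hk⟩ := hl k
      · rw [h]
        exact subset_expand _ _ hT.1
      · rw [h]
        exact subset_expand _ _ (ht l)
      · exact .inr ⟨hc, hT.exists_near symm (ht l) hk⟩
    have hsub : c '' (expand nr c T (c u))ᶜ ⊆ c '' Tᶜ :=
      Set.image_mono (Set.compl_subset_compl.2 (subset_expand T _))
    obtain ⟨h1, h2⟩ | ⟨e', rfl, h2⟩ := h
    · obtain ⟨γ, h3, h4⟩ := ih h2 (connectedFrom_expand hT _) ht'
      have hall : ∀ w, c w = c u → w ∈ expand nr c T (c u) := fun w hw => by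
        obtain ⟨k, hk⟩ := h1 w hw
        exact .inr ⟨hw, hT.exists_near symm (ht k) hk⟩
      by_cases hu : c u ∈ c '' Tᶜ
      · refine ⟨c u :: γ, ?_, h4⟩
        have : colorsLeft c (expand nr c T (c u)) < colorsLeft c T := by
          refine Set.ncard_lt_ncard ((Set.ssubset_iff_of_subset hsub).2 ⟨_, hu, ?_⟩)
            (Set.toFinite _)
          rintro ⟨w, hw, hwu⟩
          exact hw (hall w hwu)
        rw [List.length_cons]
        omega
      -- The color no longer occurs outside the territory, so the call is left out; it could not be
      -- paid for.
      · have : expand nr c T (c u) = T := by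
          refine subset_antisymm ?_ (subset_expand _ _)
          rintro w (hw | ⟨hw, -⟩)
          · exact hw
          · by_contra hwT
            exact hu ⟨w, hwT, hw⟩
        rw [this] at h3 h4
        exact ⟨γ, h3, h4⟩
    · obtain ⟨γ, h3, h4⟩ := ih h2 (connectedFrom_expand hT _) ht'
      have := Set.ncard_le_ncard hsub (Set.toFinite _)
      refine ⟨c u :: γ, ?_, h4⟩
      simp only [colorsLeft, List.length_cons] at *
      omega

/-! ### From strategies to winning states -/

/-- The vertices that the player conquers with a list of calls and whose domination he has to
watch: those that are conquered before all their neighbors that are still to be conquered. -/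
def watched (nr : V → V → Prop) (c : V → K) : Set V → List K → Set V
  | _, [] => ∅
  | T, i :: γ => (expand nr c T i \ T) ∪
      {v ∈ watched nr c (expand nr c T i) γ | ∀ u ∈ expand nr c T i \ T, ¬ nr u v}

/-- Near watched vertices are conquered by the same call, as the earlier one would otherwise stop
the watching of the later one. This is what `IsTame.exists_cover` requires. -/
theorem color_eq_of_watched (symm : ∀ a b, nr a b → nr b a) {T : Set V} {γ : List K} {u v : V}
    (hu : u ∈ watched nr c T γ) (hv : v ∈ watched nr c T γ) (hn : nr u v) : c u = c v := by
  induction γ generalizing T with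
  | nil => exact hu.elim
  | cons i γ ih =>
    obtain ⟨hu, huT⟩ | ⟨hu, hu'⟩ := hu <;> obtain ⟨hv, hvT⟩ | ⟨hv, hv'⟩ := hv
    · rw [(hu.resolve_left huT).1, (hv.resolve_left hvT).1]
    · exact absurd hn (hv' u ⟨hu, huT⟩)
    · exact absurd (symm _ _ hn) (hu' v ⟨hv, hvT⟩)
    · exact ih hu hv

theorem exists_tuple {m : ℕ} (X : Finset V) (hX : X.card ≤ m) (s : V) :
    ∃ t : Fin m → V, (∀ x ∈ X, ∃ k, t k = x) ∧ ∀ k, t k = s ∨ t k ∈ X := by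
  refine ⟨fun k => if h : (k : ℕ) < X.card then X.equivFin.symm ⟨k, h⟩ else s, ?_, ?_⟩
  · intro x hx
    refine ⟨⟨X.equivFin ⟨x, hx⟩, (X.equivFin ⟨x, hx⟩).2.trans_le hX⟩, ?_⟩
    simp
  · intro k
    by_cases h : (k : ℕ) < X.card
    · right
      simp [h]
    · left
      simp [h]

-- Follow the strategy while `X` dominates the watched vertices and `Y` lies above the owned ones;
-- five entries hold `X ∪ Y`. Both sets are thinned out after each effective call, using only old
-- members and newly conquered vertices, so the state can move along.
open Classical in
theorem IsTame.exists_wins [Fintype V] (H : IsTame nr c) (γ : List K) (T : Set V) (hs : s ∈ T)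
    (hγ : run nr c T γ = Set.univ) (X Y : Finset V) (hX : X.card ≤ 2)
    (hXc : ∀ v ∈ watched nr c T γ, ∃ x ∈ X, ¬ Avoid nr v s x) (hY : Y.card ≤ 3)
    (hYc : ∀ v ∈ T, ¬ nr s v → ∃ y ∈ Y, Below nr s v y) (t : Fin 5 → V)
    (ht : ∀ x ∈ X ∪ Y, ∃ k, t k = x) :
    ∃ e, e + colorsLeft c T ≤ γ.length ∧ Wins nr c s γ.length e t := by
  have covX : ∀ v, (∃ x ∈ X, ¬ Avoid nr v s x) → Covered nr s t v := by
    rintro v ⟨x, hx, hv⟩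
    obtain ⟨k, rfl⟩ := ht x (Finset.mem_union_left _ hx)
    exact ⟨k, hv⟩
  have covT : ∀ v ∈ T, Covered nr s t v := by
    intro v hv
    by_cases hn : nr s v
    · exact ⟨0, fun h => h.left (H.symm _ _ hn)⟩
    · obtain ⟨y, hy, hb⟩ := hYc v hv hn
      obtain ⟨k, rfl⟩ := ht y (Finset.mem_union_right _ hy)
      exact ⟨k, H.not_avoid_of_below hn hb⟩
  induction γ generalizing T X Y t with
  | nil =>
    obtain rfl : T = Set.univ := hγ
    exact ⟨0, by simp [colorsLeft], fun v => covT v trivial⟩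
  | cons i γ ih =>
    set T' := expand nr c T i with hT'
    -- A call without effect is dropped and leaves slack in both bounds.
    by_cases hnew : T' ⊆ T
    · have hTT : T' = T := hnew.antisymm (subset_expand T i)
      obtain ⟨e, h1, h2⟩ := ih T hs (by rw [← hγ]; simp [run, ← hT', hTT]) X Y hX
        (fun v hv => hXc v (.inr ⟨by rw [← hT', hTT]; exact hv, fun u hu => absurd (hnew hu.1) hu.2⟩))
        hY hYc t ht covX covT
      exact ⟨e, by simp only [List.length_cons]; omega, h2.mono_left (by simp)⟩
    obtain ⟨u, huT', huT⟩ := Set.not_subset.1 hnew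
    have hcu : c u = i := (huT'.resolve_left huT).1
    have hnewc : ∀ v ∈ T', v ∉ T → c v = i ∧ Covered nr s t v := fun v hv hvT =>
      ⟨(hv.resolve_left hvT).1, covX v (hXc v (.inl ⟨hv, hvT⟩))⟩
    let N : Finset V := Finset.univ.filter fun v => v ∈ T' ∧ v ∉ T
    have hN : ∀ v, v ∈ N ↔ v ∈ T' ∧ v ∉ T := by simp [N]
    obtain ⟨X', hX's, hX', hX'c⟩ := H.exists_cover s (watched nr c T' γ)
      (fun u hu v hv => color_eq_of_watched H.symm hu hv) (X ∪ N) (by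
        intro v hv
        -- A vertex watched from now on is either near a newly conquered vertex, which dominates it,
        -- or was already watched before and is dominated by `X`.
        by_cases hvn : ∃ w ∈ T' \ T, nr w v
        · obtain ⟨w, hw, hn⟩ := hvn
          exact ⟨w, Finset.mem_union_right _ ((hN w).2 hw), fun h => h.right (H.symm _ _ hn)⟩
        · push Not at hvn
          obtain ⟨x, hx, h⟩ := hXc v (.inr ⟨hv, hvn⟩)
          exact ⟨x, Finset.mem_union_left _ hx, h⟩)
    obtain ⟨Y', hY's, hY', hY'c⟩ := H.exists_below s {v | v ∈ T' ∧ ¬ nr s v} (Y ∪ N) (by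
        rintro v ⟨hv, hn⟩
        by_cases hvT : v ∈ T
        · obtain ⟨y, hy, h⟩ := hYc v hvT hn
          exact ⟨y, Finset.mem_union_left _ hy, h⟩
        · exact ⟨v, Finset.mem_union_right _ ((hN v).2 ⟨hv, hvT⟩), .refl hn⟩)
    obtain ⟨t', ht'1, ht'2⟩ := exists_tuple (m := 5) (X' ∪ Y')
      ((Finset.card_union_le _ _).trans (by omega)) s
    have hl : Leads nr c s t (c u) t' := by
      intro k
      refine (ht'2 k).imp_right fun hk => ?_
      have old : t' k ∈ X ∪ Y → ∃ l, t' k = t l := fun h => by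
        obtain ⟨l, hl⟩ := ht _ h
        exact ⟨l, hl.symm⟩
      have hk' : t' k ∈ X ∪ Y ∨ t' k ∈ N := by
        rcases Finset.mem_union.1 hk with h | h
        · rcases Finset.mem_union.1 (hX's h) with h | h
          · exact .inl (Finset.mem_union_left _ h)
          · exact .inr h
        · rcases Finset.mem_union.1 (hY's h) with h | h
          · exact .inl (Finset.mem_union_right _ h)
          · exact .inr h
      rw [hcu]
      exact hk'.imp old fun h => hnewc _ ((hN _).1 h).1 ((hN _).1 h).2
    have covX' : ∀ v, (∃ x ∈ X', ¬ Avoid nr v s x) → Covered nr s t' v := by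
      rintro v ⟨x, hx, hv⟩
      obtain ⟨k, rfl⟩ := ht'1 x (Finset.mem_union_left _ hx)
      exact ⟨k, hv⟩
    have covT' : ∀ v ∈ T', Covered nr s t' v := by
      intro v hv
      by_cases hn : nr s v
      · exact ⟨0, fun h => h.left (H.symm _ _ hn)⟩
      · obtain ⟨y, hy, hb⟩ := hY'c v ⟨hv, hn⟩
        obtain ⟨k, rfl⟩ := ht'1 y (Finset.mem_union_right _ hy)
        exact ⟨k, H.not_avoid_of_below hn hb⟩
    obtain ⟨e, h1, h2⟩ := ih T' (subset_expand T i hs) hγ X' Y' hX' hX'c hY'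
      (fun v hv hn => hY'c v ⟨hv, hn⟩) t' ht'1 covX' covT'
    -- The call can eliminate no color except its own.
    have hins : c '' Tᶜ ⊆ insert i (c '' T'ᶜ) := by
      rintro _ ⟨w, hw, rfl⟩
      by_cases hwT : w ∈ T'
      · exact .inl (hnewc w hwT hw).1
      · exact .inr ⟨w, hwT, rfl⟩
    by_cases hfree : ∀ w, c w = c u → Covered nr s t w
    · refine ⟨e, ?_, .inr ⟨u, t', hl, .inl ⟨hfree, h2⟩⟩⟩
      have := (Set.ncard_le_ncard hins (Set.toFinite _)).trans (Set.ncard_insert_le _ _)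
      simp only [colorsLeft, List.length_cons] at *
      omega
    -- An undominated vertex of color `i` cannot be in `T'`, all of which the state dominates. So
    -- the color remains, and the call counts as extra.
    · refine ⟨e + 1, ?_, .inr ⟨u, t', hl, .inr ⟨e, rfl, h2⟩⟩⟩
      push Not at hfree
      obtain ⟨w, hw, hwc⟩ := hfree
      have hwT : w ∉ T' := fun h => by
        by_cases hwT : w ∈ T
        · exact hwc (covT w hwT)
        · exact hwc (hnewc w h hwT).2
      have hi : i ∈ c '' T'ᶜ := ⟨w, hwT, hw.trans hcu⟩
      rw [Set.insert_eq_self.2 hi] at hins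
      have := Set.ncard_le_ncard hins (Set.toFinite _)
      simp only [colorsLeft, List.length_cons] at *
      omega

/-- A watched vertex is conquered through a near vertex; if that one had been added after `T`, the
watching would have ended. -/
theorem exists_near_of_watched {T : Set V} {γ : List K} {v : V} (hv : v ∈ watched nr c T γ) :
    ∃ u ∈ T, nr u v := by
  induction γ generalizing T with
  | nil => exact hv.elim
  | cons i γ ih =>
    obtain ⟨hv, hvT⟩ | ⟨hv, hv'⟩ := hv
    · exact (hv.resolve_left hvT).2
    · obtain ⟨u, hu, hn⟩ := ih hv
      exact ⟨u, by_contra fun huT => hv' u ⟨hu, huT⟩ hn, hn⟩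

/-- The vertices of the block of `s` are owned from the beginning. -/
theorem IsTame.exists_wins_source [Fintype V] (H : IsTame nr c) {γ : List K}
    (hγ : run nr c {v | nr s v ∧ c s = c v} γ = Set.univ) :
    ∃ e, e + colorsLeft c {v | nr s v ∧ c s = c v} ≤ γ.length ∧
      Wins nr c s γ.length e fun _ : Fin 5 => s := by
  classical
  refine H.exists_wins γ {v | nr s v ∧ c s = c v} ⟨H.refl s, rfl⟩ hγ {s} ∅ (by simp) ?_ (by simp)
    (fun v hv hn => absurd hv.1 hn) _ (by simp)
  intro v hv
  obtain ⟨u, ⟨hu, hc⟩, hn⟩ := exists_near_of_watched hv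
  exact ⟨s, by simp, fun h => h.left
    (H.twin u s (H.symm _ _ hu) hc.symm v (H.symm _ _ hn))⟩

/-- By connectivity some call always gains a vertex. The resulting bound limits the rounds and the
extra calls that have to be tabulated. -/
theorem exists_run_eq_univ [Finite V] (hconn : ∀ v, Relation.ReflTransGen nr s v) (T : Set V)
    (hs : s ∈ T) : ∃ γ : List K, γ.length ≤ Tᶜ.ncard ∧ run nr c T γ = Set.univ := by
  induction hk : Tᶜ.ncard using Nat.strong_induction_on generalizing T with
  | _ k ih =>
    by_cases hT : T = Set.univ
    · exact ⟨[], Nat.zero_le _, hT⟩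
    obtain ⟨u, hu, v, hv, hn⟩ : ∃ u ∈ T, ∃ v ∉ T, nr u v := by
      by_contra! hcon
      refine hT (Set.eq_univ_of_forall fun v => ?_)
      have := hconn v
      induction this with
      | refl => exact hs
      | tail _ h2 ih => exact by_contra fun h => hcon _ ih _ h h2
    have hv' : v ∈ expand nr c T (c v) := .inr ⟨rfl, u, hu, hn⟩
    have hlt : (expand nr c T (c v))ᶜ.ncard < Tᶜ.ncard :=
      Set.ncard_lt_ncard ((Set.ssubset_iff_of_subset
        (Set.compl_subset_compl.2 (subset_expand T _))).2 ⟨v, hv, fun h => h hv'⟩) (Set.toFinite _)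
    obtain ⟨γ, h1, h2⟩ := ih _ (hk ▸ hlt) _ (subset_expand _ _ hs) rfl
    exact ⟨c v :: γ, by rw [List.length_cons]; omega, h2⟩

end Game

/-! ### The game on a graph -/

section Blocks

variable {V K : Type*} {G : SimpleGraph V} {c : V → K}

/-- Two vertices are in the same block if they are joined by a monochromatic walk. -/
def SameBlock (G : SimpleGraph V) (c : V → K) : V → V → Prop :=
  Relation.ReflTransGen fun x y => G.Adj x y ∧ c x = c y

/-- Two vertices are near if their blocks are equal or adjacent. -/
def Near (G : SimpleGraph V) (c : V → K) (u v : V) : Prop :=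
  ∃ u' v', SameBlock G c u u' ∧ SameBlock G c v v' ∧ (u' = v' ∨ G.Adj u' v')

theorem SameBlock.symm {u v : V} (h : SameBlock G c u v) : SameBlock G c v u := by
  induction h with
  | refl => exact .refl
  | tail _ h ih => exact (Relation.ReflTransGen.single ⟨h.1.symm, h.2.symm⟩).trans ih

theorem SameBlock.color_eq {u v : V} (h : SameBlock G c u v) : c u = c v := by
  induction h with
  | refl => rfl
  | tail _ h ih => exact ih.trans h.2

theorem Near.refl (u : V) : Near G c u u := ⟨u, u, .refl, .refl, .inl rfl⟩

theorem Near.symm {u v : V} (h : Near G c u v) : Near G c v u := by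
  obtain ⟨u', v', hu, hv, h⟩ := h
  exact ⟨v', u', hv, hu, h.imp Eq.symm SimpleGraph.Adj.symm⟩

theorem Near.congr_right {u v w : V} (h : Near G c u v) (k : SameBlock G c v w) : Near G c u w := by
  obtain ⟨u', v', hu, hv, h⟩ := h
  exact ⟨u', v', hu, k.symm.trans hv, h⟩

theorem Near.of_adj {u v : V} (h : G.Adj u v) : Near G c u v := ⟨u, v, .refl, .refl, .inr h⟩

theorem SameBlock.near {u v : V} (h : SameBlock G c u v) : Near G c u v :=
  (Near.refl u).congr_right h

theorem sameBlock_iff {u v : V} : SameBlock G c u v ↔ Near G c u v ∧ c u = c v := by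
  refine ⟨fun h => ⟨h.near, h.color_eq⟩, ?_⟩
  rintro ⟨⟨u', v', hu, hv, h | h⟩, hc⟩
  · subst h
    exact hu.trans hv.symm
  · exact (hu.tail ⟨h, by rw [← hu.color_eq, hc, hv.color_eq]⟩).trans hv.symm

theorem exists_walk_iff {u v : V} {P : V → Prop} :
    (∃ p : G.Walk u v, ∀ x ∈ p.support, P x) ↔
      P u ∧ Relation.ReflTransGen (fun x y => G.Adj x y ∧ P y) u v := by
  constructor
  · rintro ⟨p, hp⟩
    refine ⟨hp u p.start_mem_support, ?_⟩
    induction p with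
    | nil => exact .refl
    | cons h p ih =>
      simp only [SimpleGraph.Walk.support_cons, List.mem_cons, forall_eq_or_imp] at hp
      exact .head ⟨h, hp.2 _ p.start_mem_support⟩ (ih hp.2)
  · rintro ⟨hu, h⟩
    induction h with
    | refl => exact ⟨.nil, by simpa using hu⟩
    | tail _ h ih =>
      obtain ⟨p, hp⟩ := ih
      refine ⟨p.concat h.1, fun x hx => ?_⟩
      rw [SimpleGraph.Walk.support_concat, List.mem_append] at hx
      obtain hx | hx := hx
      · exact hp x hx
      · rw [List.mem_singleton.1 hx]
        exact h.2

/-- Nearness to `d` is constant on blocks, so each step can be replaced by a walk in `G` through the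
two blocks involved. -/
theorem joinedAvoiding_of_avoid {a b d : V} (h : Avoid (Near G c) d a b) :
    JoinedAvoiding G a b d := by
  classical
  obtain ⟨p, hp⟩ := (exists_walk_iff (G := G) (u := a) (v := b) (P := fun x => ¬ Near G c d x)).2 (by
    refine ⟨h.left, ?_⟩
    have block : ∀ {x y}, SameBlock G c x y → ¬ Near G c d x →
        Relation.ReflTransGen (fun x y => G.Adj x y ∧ ¬ Near G c d y) x y := by
      intro x y hxy hx
      induction hxy with
      | refl => exact .refl
      | @tail y z h1 h2 ih =>
        exact ih.tail ⟨h2.1, fun hn => hx (hn.congr_right (SameBlock.symm (h1.tail h2)))⟩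
    induction h with
    | refl _ => exact .refl
    | @tail x y h1 h2 h3 ih =>
      obtain ⟨x', y', hx, hy, h⟩ := h2
      have hy' : ¬ Near G c d y' := fun hn => h3 (hn.congr_right hy.symm)
      refine (ih.trans (block hx h1.right)).trans ?_
      obtain h | h := h
      · rw [h]
        exact block hy.symm hy'
      · exact .head ⟨h, hy'⟩ (block hy.symm hy'))
  refine ⟨p.toPath, p.toPath.2, fun v hv => ?_⟩
  have hv' := hp v (p.support_toPath_subset_support hv)
  exact ⟨fun e => hv' (e ▸ Near.refl _), fun h => hv' (.of_adj h)⟩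

theorem ATFree.isTame (hG : ATFree G) (c : V → K) : IsTame (Near G c) c where
  refl := Near.refl
  symm _ _ := Near.symm
  twin a b h hc v hv := hv.congr_right (sameBlock_iff.2 ⟨h, hc⟩)
  no_triple a b d h1 h2 h3 := by
    have ne : ∀ {x y z}, Avoid (Near G c) x y z → x ≠ y ∧ ¬ G.Adj x y := fun h =>
      ⟨fun e => h.left (e ▸ Near.refl _), fun h' => h.left (.of_adj h')⟩
    have symm : ∀ {x y z}, Avoid (Near G c) x y z → Avoid (Near G c) x z y :=
      Avoid.symm fun _ _ => Near.symm
    exact hG a b d ⟨(ne h1).1, (ne (symm h2)).1, (ne (symm h1)).1, (ne h1).2, (ne (symm h2)).2,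
      (ne (symm h1)).2, joinedAvoiding_of_avoid h3, joinedAvoiding_of_avoid h1,
      joinedAvoiding_of_avoid h2⟩

/-! ### Positions of the real game as unions of blocks -/

/-- The coloring `c'` has arisen from `c` by recoloring the territory `T`. -/
structure IsPosition (G : SimpleGraph V) (s : V) (c c' : V → K) (T : Set V) : Prop where
  source : s ∈ T
  inside : ∀ v ∈ T, c' v = c' s
  outside : ∀ v, v ∉ T → c' v = c v
  block : ∀ u ∈ T, ∀ v, SameBlock G c u v → v ∈ T
  reach : ∀ v ∈ T, Relation.ReflTransGen (fun x y => G.Adj x y ∧ y ∈ T) s v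
  border : ∀ u ∈ T, ∀ v, v ∉ T → G.Adj u v → c v ≠ c' s

variable {s : V}

theorem IsPosition.territory_eq {c' : V → K} {T : Set V} (h : IsPosition G s c c' T) :
    territory G s c' = T := by
  ext v
  rw [territory, Set.mem_ofPred_eq, exists_walk_iff]
  constructor
  · rintro ⟨-, hv⟩
    induction hv with
    | refl => exact h.source
    | tail _ h2 ih =>
      by_contra hT
      exact h.border _ ih _ hT h2.1 ((h.outside _ hT).symm.trans h2.2)
  · intro hv
    exact ⟨rfl, (h.reach v hv).lift id fun x y hxy => ⟨hxy.1, h.inside y hxy.2⟩⟩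

/-- Because `T` is a union of blocks, calling `i` attaches whole blocks of original color `i`. A
further neighbor of color `i` would be near `T` or lie in one of these blocks. -/
theorem IsPosition.move {c' : V → K} {T : Set V} (h : IsPosition G s c c' T) (i : K) :
    IsPosition G s c (move G s c' i) (expand (Near G c) c T i) := by
  have hin : ∀ v ∈ T, FloodIt.move G s c' i v = i := fun v hv => by
    simp [FloodIt.move, h.territory_eq, hv]
  have hout : ∀ v, v ∉ T → FloodIt.move G s c' i v = c v := fun v hv => by
    simp [FloodIt.move, h.territory_eq, hv, h.outside v hv]
  have hs := hin s h.source
  have hblock : ∀ u ∈ expand (Near G c) c T i, ∀ v, SameBlock G c u v →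
      v ∈ expand (Near G c) c T i := by
    rintro u (hu | ⟨hc, w, hw, hn⟩) v huv
    · exact .inl (h.block u hu v huv)
    · exact .inr ⟨huv.color_eq.symm.trans hc, w, hw, hn.congr_right huv⟩
  refine ⟨.inl h.source, ?_, ?_, hblock, ?_, ?_⟩
  · rw [hs]
    rintro v (hv | ⟨hc, hv⟩)
    · exact hin v hv
    · by_cases hvT : v ∈ T
      · exact hin v hvT
      · rw [hout v hvT, hc]
  · exact fun v hv => hout v fun hvT => hv (.inl hvT)
  · have old : ∀ v ∈ T, Relation.ReflTransGen
        (fun x y => G.Adj x y ∧ y ∈ expand (Near G c) c T i) s v :=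
      fun v hv => (h.reach v hv).lift id fun x y hxy => ⟨hxy.1, .inl hxy.2⟩
    have along : ∀ {u v}, u ∈ expand (Near G c) c T i → SameBlock G c u v →
        Relation.ReflTransGen (fun x y => G.Adj x y ∧ y ∈ expand (Near G c) c T i) u v := by
      intro u v hu huv
      induction huv with
      | refl => exact .refl
      | tail h1 h2 ih => exact ih.tail ⟨h2.1, hblock _ hu _ (h1.tail h2)⟩
    intro v hv
    obtain hvT | ⟨hc, u, hu, u', v', hu', hv', h'⟩ := id hv
    · exact old v hvT
    · have hv'E := hblock v hv v' hv'
      refine Relation.ReflTransGen.trans ?_ (along hv'E hv'.symm)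
      have hu'T := h.block u hu u' hu'
      obtain h' | h' := h'
      · exact h' ▸ old u' hu'T
      · exact (old u' hu'T).tail ⟨h', hv'E⟩
  · rw [hs]
    rintro u hu v hv huv hc
    obtain hu | ⟨hcu, hu'⟩ := id hu
    · exact hv (.inr ⟨hc, u, hu, .of_adj huv⟩)
    · exact hv (hblock u hu v (.single ⟨huv, hcu.trans hc.symm⟩))

theorem isPosition_start (G : SimpleGraph V) (s : V) (c : V → K) :
    IsPosition G s c c {v | SameBlock G c s v} where
  source := .refl
  inside v hv := hv.color_eq.symm
  outside _ _ := rfl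
  block u hu v huv := Relation.ReflTransGen.trans hu huv
  reach v hv := by
    replace hv : SameBlock G c s v := hv
    induction hv with
    | refl => exact .refl
    | tail h1 h2 ih => exact ih.tail ⟨h2.1, h1.tail h2⟩
  border u hu v hv huv hc := hv (hu.tail ⟨huv, hu.color_eq.symm.trans hc.symm⟩)

theorem isStrategy_iff {γ : List K} :
    IsStrategy G s c γ ↔ run (Near G c) c {v | SameBlock G c s v} γ = Set.univ := by
  suffices H : ∀ c' T, IsPosition G s c c' T →
      territory G s (play G s c' γ) = run (Near G c) c T γ by
    rw [IsStrategy, H c _ (isPosition_start G s c)]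
  induction γ with
  | nil => exact fun c' T h => h.territory_eq
  | cons i γ ih => exact fun c' T h => ih _ _ (h.move i)

open Classical in
theorem isMinMoves_of_atFree {n : ℕ} {G : SimpleGraph (Fin n)} (hc : G.Connected) (hG : ATFree G)
    (s : Fin n) (c : Fin n → K) :
    IsMinMoves G s c (colorsLeft c {v | SameBlock G c s v} + ∑ e ∈ Finset.range n,
      if Wins (Near G c) c s n e (fun _ : Fin 5 => s) then 0 else 1) := by
  have H := hG.isTame c
  set T : Set (Fin n) := {v | SameBlock G c s v} with hT
  have hT' : T = {v | Near G c s v ∧ c s = c v} := Set.ext fun v => sameBlock_iff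
  have hs : s ∈ T := Relation.ReflTransGen.refl
  have hconn : ∀ v, Relation.ReflTransGen (Near G c) s v := fun v => by
    obtain ⟨p⟩ := hc.preconnected s v
    have := (exists_walk_iff (G := G) (P := fun _ => True)).1 ⟨p, by simp⟩
    exact this.2.lift id fun x y h => .of_adj h.1
  have hcompl : Tᶜ.ncard < n := by
    have := Set.ncard_lt_ncard ((Set.ssubset_univ_iff (s := Tᶜ)).2 fun h => by
      have : s ∈ Tᶜ := h ▸ Set.mem_univ s
      exact this hs) (Set.toFinite _)
    simpa using this
  obtain ⟨γ₀, hγ₀, hγ₀'⟩ := exists_run_eq_univ (c := c) hconn T hs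
  have lower : ∀ γ, run (Near G c) c T γ = Set.univ → ∃ e, e + colorsLeft c T ≤ γ.length ∧
      Wins (Near G c) c s γ.length e fun _ : Fin 5 => s := by
    rw [hT']
    exact fun γ hγ => H.exists_wins_source hγ
  have hex : ∃ e, e < n ∧ Wins (Near G c) c s n e fun _ : Fin 5 => s := by
    obtain ⟨e, h1, h2⟩ := lower γ₀ hγ₀'
    exact ⟨e, by omega, h2.mono_left (by omega)⟩
  have hex' : ∃ e, Wins (Near G c) c s n e fun _ : Fin 5 => s := hex.imp fun _ h => h.2
  set E := Nat.find hex' with hE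
  have hEn : E < n := by
    obtain ⟨e, h1, h2⟩ := hex
    exact (Nat.find_min' hex' h2).trans_lt h1
  -- `Wins` is monotone in `e`, so the number of failing values below `n` is the threshold `E`.
  have hsum : (∑ e ∈ Finset.range n,
      if Wins (Near G c) c s n e (fun _ : Fin 5 => s) then 0 else 1) = E := by
    have : ∀ e, (if Wins (Near G c) c s n e (fun _ : Fin 5 => s) then 0 else 1) =
        if e < E then 1 else 0 := fun e => by
      by_cases h : e < E
      · rw [if_neg (Nat.find_min hex' h), if_pos h]
      · rw [if_pos ((Nat.find_spec hex').mono_right (not_lt.1 h)), if_neg h]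
    simp only [this, Finset.sum_boole, Nat.cast_id]
    have : (Finset.range n).filter (· < E) = Finset.range E := by
      ext e
      simp only [Finset.mem_filter, Finset.mem_range]
      omega
    rw [this, Finset.card_range]
  rw [hsum]
  have low : ∀ γ, run (Near G c) c T γ = Set.univ → colorsLeft c T + E ≤ γ.length := by
    intro γ hγ
    by_cases hle : γ.length ≤ n
    · obtain ⟨e, h1, h2⟩ := lower γ hγ
      have := Nat.find_min' hex' (h2.mono_left hle)
      omega
    · obtain ⟨e, h1, h2⟩ := lower γ₀ hγ₀'
      have := Nat.find_min' hex' (h2.mono_left (by omega : γ₀.length ≤ n))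
      omega
  constructor
  · obtain ⟨γ, h1, h2⟩ := (Nat.find_spec hex').exists_run (fun _ _ => Near.symm) (T := T)
      ⟨hs, (isPosition_start G s c).reach |> fun h v hv => (h v hv).lift id fun x y hxy =>
        ⟨Near.of_adj hxy.1, hxy.2⟩⟩ (fun _ => hs)
    exact ⟨γ, by have := low γ h2; omega, isStrategy_iff.2 h2⟩
  · rintro l ⟨γ, rfl, hγ⟩
    exact low γ (isStrategy_iff.1 hγ)

end Blocks

/-! ### The program -/

theorem IsTable.pair {n a : ℕ} {σ : Memory} {P : (Fin 2 → Fin n) → Prop} (h : IsTable σ a P)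
    (u v : Fin n) : σ a (digits n [(u : ℕ), (v : ℕ)]) ≠ 0 ↔ P ![u, v] := by
  rw [← h]
  simp

theorem IsTable.six {n a : ℕ} {σ : Memory} {P : (Fin 6 → Fin n) → Prop} (h : IsTable σ a P)
    (e u v w x y : Fin n) :
    σ a (digits n [(e : ℕ), (u : ℕ), (v : ℕ), (w : ℕ), (x : ℕ), (y : ℕ)]) ≠ 0 ↔
      P ![e, u, v, w, x, y] := by
  rw [← h]
  simp

theorem IsTable.congr {m n a : ℕ} {σ τ : Memory} {P Q : (Fin m → Fin n) → Prop}
    (h : IsTable σ a P) (hσ : τ a = σ a) (hP : ∀ f, P f ↔ Q f) : IsTable τ a Q := fun f => by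
  rw [hσ, h f, hP f]

theorem vec_two {n : ℕ} (f : Fin 2 → Fin n) : ![f 0, f 1] = f := by
  ext i
  fin_cases i <;> rfl

/-- Fill the table `a` with a reachability relation, where `I` says which vertices `1` are the
sources for the parameter `0`, and `E` which vertices `1` can be reached from `2` in one step. -/
def Stmt.closure (a b : ℕ) (I E : Term) : Stmt :=
  .seq (.fill a (List.range 2) I)
    (.iterate a b 2 (.or (.cell a [0, 1]) (.ex 2 (.and (.cell a [0, 2]) E))))

theorem Stmt.ok_closure {a b : ℕ} {I E : Term} (ha : a ≠ 0 ∧ a ≠ 4 ∧ a ≠ 5)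
    (hb : b ≠ 0 ∧ b ≠ 4 ∧ b ≠ 5) (hI : I.Ok) (hE : E.Ok) : (Stmt.closure a b I E).Ok := by
  refine ⟨ok_fill ha hI, ok_iterate ha hb ?_⟩
  obtain ⟨h1, h2⟩ := hE
  simp [Term.Ok, Term.reads, Term.or, Term.and, Term.ex, Term.neg, Term.cell, Term.index, h1, h2]
  omega

/-- The first coordinate is only a parameter, so each row of the table evolves independently. -/
theorem iterate_rows_iff {n : ℕ} (E : Fin n → Fin n → Fin n → Prop) (P : (Fin 2 → Fin n) → Prop)
    (r : ℕ) (u a : Fin n) :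
    (fun P f => P f ∨ ∃ w, P ![f 0, w] ∧ E (f 0) w (f 1))^[r] P ![u, a] ↔
      (fun (Q : Fin n → Prop) b => Q b ∨ ∃ w, Q w ∧ E u w b)^[r] (fun b => P ![u, b]) a := by
  induction r generalizing a with
  | zero => rfl
  | succ r ih =>
    simp only [Function.iterate_succ_apply']
    simp [ih]

theorem Stmt.exec_closure {n a b : ℕ} (ha : a ≠ 0) (hb : b ≠ 0) (hab : a ≠ b) {I E : Term}
    (hI : a ∉ I.reads) (hE : b ∉ E.reads) (ρ : ℕ → ℕ) {σ : Memory} (hn : σ 0 0 = n)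
    {i : Fin n → Fin n → Prop} {e : Fin n → Fin n → Fin n → Prop}
    (hi : ∀ f : Fin 2 → Fin n, I.Holds σ (withVars ρ f) ↔ i (f 0) (f 1))
    (he : ∀ ρ τ, (∀ c, c ≠ a → c ≠ b → τ c = σ c) → ∀ (f : Fin 2 → Fin n) (w : Fin n),
      E.Holds τ (Function.update (withVars ρ f) 2 w) ↔ e (f 0) w (f 1)) :
    (∀ c, c ≠ a → c ≠ b → (Stmt.closure a b I E).exec ρ σ c = σ c) ∧
      IsTable ((Stmt.closure a b I E).exec ρ σ) a fun f : Fin 2 → Fin n =>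
        ∃ u, i (f 0) u ∧ Relation.ReflTransGen (e (f 0)) u (f 1) := by
  obtain ⟨h1, h2⟩ := exec_fill (m := 2) ha (by decide) hI ρ hn
  simp only [closure, exec]
  set τ := (Stmt.fill a (List.range 2) I).exec ρ σ
  have hτ : τ 0 0 = n := by rw [h1 0 ha.symm, hn]
  obtain ⟨h3, h4⟩ := exec_iterate (m := 2) (b := b)
    (h := .or (.cell a [0, 1]) (.ex 2 (.and (.cell a [0, 2]) E))) ha hb hab (by decide) (by
      simp [Term.reads, Term.or, Term.and, Term.ex, Term.neg, Term.cell, Term.index, hE]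
      omega) ρ hτ h2 (fun P f => P f ∨ ∃ w, P ![f 0, w] ∧ e (f 0) w (f 1)) (by
      intro ρ υ P hυ hP f
      have hυ0 : υ 0 0 = n := by rw [hυ 0 ha.symm hb.symm, hτ]
      simp only [Term.holds_or, Term.holds_ex_fin hυ0, Term.holds_and,
        he ρ υ (fun c hca hcb => (hυ c hca hcb).trans (h1 c hca))]
      rw [Term.holds_cell (by decide)]
      simp only [Term.holds_cell (l := [0, 2]) (by decide), hυ0]
      simp [withVars, hP.pair, vec_two])
  refine ⟨fun c hca hcb => (h3 c hca hcb).trans (h1 c hca), h4.congr rfl fun f => ?_⟩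
  rw [← vec_two f, iterate_rows_iff, iterate_reach_iff]
  simp [hi]

/-- The memory holds an instance of the game. -/
structure IsInstance {n k : ℕ} (G : SimpleGraph (Fin n)) (s : Fin n) (c : Fin n → Fin k)
    (σ : Memory) : Prop where
  size : σ 0 0 = n
  source : σ 0 2 = s
  color : ∀ u : Fin n, σ 1 u = c u
  adj : IsTable σ 2 fun f : Fin 2 → Fin n => G.Adj (f 0) (f 1)

/-- Tables put the first coordinate in the last digit, whereas the input is stored row by row. The
table read is thus the transpose, which is harmless as adjacency is symmetric. -/
theorem isInstance_input {n k : ℕ} (G : SimpleGraph (Fin n)) (s : Fin n) (c : Fin n → Fin k) :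
    IsInstance G s c (input G s c) where
  size := rfl
  source := rfl
  color u := by simp [input]
  adj f := by
    rw [← vec_two f]
    simp only [input, List.ofFn_succ, List.ofFn_zero, digits]
    simp only [ne_eq, ite_eq_right_iff, one_ne_zero, imp_false, not_not]
    constructor
    · rintro ⟨u, v, h, huv⟩
      have := digits_inj (n := n) (l := [(v : ℕ), (u : ℕ)]) (m := [(f 0 : ℕ), (f 1 : ℕ)]) rfl
        (by simp) (by simp) (by simpa [digits] using h.symm)
      simp only [List.cons.injEq, Fin.val_inj, and_true] at this
      rw [← this.1, ← this.2]
      exact huv.symm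
    · intro h
      exact ⟨f 1, f 0, by simp, h.symm⟩

variable {n k : ℕ} {G : SimpleGraph (Fin n)} {s : Fin n} {c : Fin n → Fin k} {σ : Memory}

theorem IsInstance.congr (h : IsInstance G s c σ) {τ : Memory} (h0 : τ 0 = σ 0) (h1 : τ 1 = σ 1)
    (h2 : τ 2 = σ 2) : IsInstance G s c τ where
  size := by rw [h0, h.size]
  source := by rw [h0, h.source]
  color u := by rw [h1, h.color]
  adj := h.adj.congr h2 fun _ => Iff.rfl

namespace Term

/-- The source. -/
def source : Term := .rd 0 (.lit 2)

/-- The color of a vertex. -/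
def color (x : ℕ) : Term := .rd 1 (.var x)

end Term

/-- Tabulate in array `6` which vertices are in the same block. -/
def blockStmt : Stmt := .closure 6 7 (.eq (.var 1) (.var 0))
  (.and (.cell 2 [2, 1]) (.eq (.color 2) (.color 1)))

theorem exec_blockStmt (h : IsInstance G s c σ) (ρ : ℕ → ℕ) :
    (∀ a, a ≠ 6 → a ≠ 7 → blockStmt.exec ρ σ a = σ a) ∧
      IsTable (blockStmt.exec ρ σ) 6 fun f : Fin 2 → Fin n => SameBlock G c (f 0) (f 1) := by
  obtain ⟨h1, h2⟩ := Stmt.exec_closure (a := 6) (b := 7) (n := n) (by decide) (by decide)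
    (by decide) (I := .eq (.var 1) (.var 0))
    (E := .and (.cell 2 [2, 1]) (.eq (.color 2) (.color 1))) (by decide) (by decide) ρ h.size
    (i := fun u v => v = u) (e := fun _ w v => G.Adj w v ∧ c w = c v)
    (by simp [Term.eval, withVars, Fin.val_inj]) (by
      intro ρ τ hτ f w
      have H := h.congr (hτ 0 (by decide) (by decide)) (hτ 1 (by decide) (by decide))
        (hτ 2 (by decide) (by decide))
      simp only [Term.holds_and, Term.holds_eq, Term.holds_cell (l := [2, 1]) (by decide), H.size]
      simp [withVars, H.adj.pair, Term.color, Term.eval, H.color,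
        Fin.val_inj])
  refine ⟨h1, h2.congr rfl fun f => ?_⟩
  simp [SameBlock]

/-- Tabulate in array `8` which vertices are near. -/
def nearStmt : Stmt := .fill 8 (List.range 2) <| .ex 2 <| .ex 3 <| .and (.cell 6 [0, 2]) <|
  .and (.cell 6 [1, 3]) <| .or (.eq (.var 2) (.var 3)) (.cell 2 [2, 3])

theorem exec_nearStmt (h : IsInstance G s c σ)
    (h6 : IsTable σ 6 fun f : Fin 2 → Fin n => SameBlock G c (f 0) (f 1)) (ρ : ℕ → ℕ) :
    (∀ a, a ≠ 8 → nearStmt.exec ρ σ a = σ a) ∧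
      IsTable (nearStmt.exec ρ σ) 8 fun f : Fin 2 → Fin n => Near G c (f 0) (f 1) := by
  obtain ⟨h1, h2⟩ := Stmt.exec_fill (a := 8) (m := 2) (by decide) (by decide) (h := .ex 2 <| .ex 3 <|
    .and (.cell 6 [0, 2]) <| .and (.cell 6 [1, 3]) <| .or (.eq (.var 2) (.var 3)) (.cell 2 [2, 3]))
    (by decide) ρ h.size
  refine ⟨h1, h2.congr rfl fun f => ?_⟩
  simp only [Term.holds_ex_fin h.size, Term.holds_and, Term.holds_or, Term.holds_eq,
    Term.holds_cell (l := [0, 2]) (by decide), Term.holds_cell (l := [1, 3]) (by decide),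
    Term.holds_cell (l := [2, 3]) (by decide), h.size]
  simp [withVars, h.adj.pair, h6.pair, Term.eval, Fin.val_inj, Near]

/-- Tabulate in array `9` which vertices can be reached from the source by a walk that avoids the
neighborhood of a given vertex. -/
def avoidStmt : Stmt := .closure 9 10 (.and (.eq (.var 1) .source) (.neg (.cell 8 [0, 1])))
  (.and (.cell 8 [2, 1]) (.neg (.cell 8 [0, 1])))

theorem exec_avoidStmt (h : IsInstance G s c σ)
    (h8 : IsTable σ 8 fun f : Fin 2 → Fin n => Near G c (f 0) (f 1)) (ρ : ℕ → ℕ) :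
    (∀ a, a ≠ 9 → a ≠ 10 → avoidStmt.exec ρ σ a = σ a) ∧
      IsTable (avoidStmt.exec ρ σ) 9 fun f : Fin 2 → Fin n => Avoid (Near G c) (f 0) s (f 1) := by
  obtain ⟨h1, h2⟩ := Stmt.exec_closure (a := 9) (b := 10) (n := n) (by decide) (by decide)
    (by decide) (I := .and (.eq (.var 1) .source) (.neg (.cell 8 [0, 1])))
    (E := .and (.cell 8 [2, 1]) (.neg (.cell 8 [0, 1]))) (by decide) (by decide) ρ h.size
    (i := fun v a => a = s ∧ ¬ Near G c v a) (e := fun v w a => Near G c w a ∧ ¬ Near G c v a)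
    (by
      intro f
      simp only [Term.holds_and, Term.holds_eq, Term.holds_neg,
        Term.holds_cell (l := [0, 1]) (by decide), h.size]
      simp [withVars, Term.source, Term.eval, h.source, h8.pair, Fin.val_inj]) (by
      intro ρ τ hτ f w
      have H := h.congr (hτ 0 (by decide) (by decide)) (hτ 1 (by decide) (by decide))
        (hτ 2 (by decide) (by decide))
      have H8 := h8.congr (hτ 8 (by decide) (by decide)) fun _ => Iff.rfl
      simp only [Term.holds_and, Term.holds_neg, Term.holds_cell (l := [2, 1]) (by decide),
        Term.holds_cell (l := [0, 1]) (by decide), H.size]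
      simp [withVars, H8.pair])
  refine ⟨h1, h2.congr rfl fun f => ?_⟩
  generalize f 1 = a
  constructor
  · rintro ⟨u, ⟨rfl, hu⟩, hf⟩
    induction hf with
    | refl => exact .refl hu
    | tail _ h ih => exact ih.tail h.1 h.2
  · intro hf
    induction hf with
    | refl h => exact ⟨s, ⟨rfl, h⟩, .refl⟩
    | tail _ h2 h3 ih =>
      obtain ⟨u, hu, hr⟩ := ih
      exact ⟨u, hu, hr.tail ⟨h2, h3⟩⟩

variable {n k : ℕ} {G : SimpleGraph (Fin n)} {s : Fin n} {c : Fin n → Fin k} {σ : Memory}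

/-! ### The recursion for winning states as a formula -/

namespace Term

/-- The vertex `x` is dominated by the state that the variables `1` to `5` hold. -/
def covered (x : ℕ) : Term :=
  .or (.neg (.cell 9 [x, 1])) <| .or (.neg (.cell 9 [x, 2])) <| .or (.neg (.cell 9 [x, 3])) <|
    .or (.neg (.cell 9 [x, 4])) (.neg (.cell 9 [x, 5]))

/-- Everything is dominated by the state. -/
def finished : Term := .all 6 (covered 6)

/-- The player can own the vertex `y` after the color of the vertex `7` is called. -/
def leads (y : ℕ) : Term :=
  .or (.eq (.var y) source) <| .or (.or (.eq (.var y) (.var 1)) <| .or (.eq (.var y) (.var 2)) <|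
    .or (.eq (.var y) (.var 3)) <| .or (.eq (.var y) (.var 4)) (.eq (.var y) (.var 5))) <|
    .and (.eq (color y) (color 7)) (covered y)

/-- The color of the vertex `7` is dominated by the state. -/
def free : Term := .all 6 (.or (.neg (.eq (color 6) (color 7))) (covered 6))

/-- One step of the recursion for the winning states. -/
def winStep : Term :=
  .or finished <| .ex 7 <| .ex 8 <| .ex 9 <| .ex 10 <| .ex 11 <| .ex 12 <|
    .and (.and (leads 8) <| .and (leads 9) <| .and (leads 10) <| .and (leads 11) (leads 12)) <|
    .or (.and free (.cell 11 [0, 8, 9, 10, 11, 12])) <|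
      .ex 13 <| .and (.eq (.add (.var 13) (.lit 1)) (.var 0)) (.cell 11 [13, 8, 9, 10, 11, 12])

variable {ρ : ℕ → ℕ}

theorem holds_covered (h : IsInstance G s c σ)
    (h9 : IsTable σ 9 fun f : Fin 2 → Fin n => Avoid (Near G c) (f 0) s (f 1)) {x : ℕ} {v : Fin n}
    (hx : x ≠ 100) (hv : ρ x = v) {t : Fin 5 → Fin n} (ht : ∀ i : Fin 5, ρ (i + 1) = t i) :
    Holds σ ρ (covered x) ↔ Covered (Near G c) s t v := by
  have cell : ∀ i : Fin 5, Holds σ ρ (.cell 9 [x, i + 1]) ↔ Avoid (Near G c) v s (t i) := by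
    intro i
    rw [holds_cell (by simp [hx.symm]; omega), h.size]
    simpa [hv, ht] using h9.pair v (t i)
  simp only [covered, holds_or, holds_neg, Covered, Fin.exists_fin_succ]
  have h0 := cell 0
  have h1 := cell 1
  have h2 := cell 2
  have h3 := cell 3
  have h4 := cell 4
  simp at h0 h1 h2 h3 h4
  simp [h0, h1, h2, h3, h4]

theorem holds_finished (h : IsInstance G s c σ)
    (h9 : IsTable σ 9 fun f : Fin 2 → Fin n => Avoid (Near G c) (f 0) s (f 1))
    {t : Fin 5 → Fin n} (ht : ∀ i : Fin 5, ρ (i + 1) = t i) :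
    Holds σ ρ finished ↔ ∀ v, Covered (Near G c) s t v := by
  rw [finished, holds_all_fin h.size]
  refine forall_congr' fun v => holds_covered h h9 (by decide) (by simp) fun i => ?_
  rw [Function.update_of_ne (by omega), ht]

theorem holds_leads (h : IsInstance G s c σ)
    (h9 : IsTable σ 9 fun f : Fin 2 → Fin n => Avoid (Near G c) (f 0) s (f 1)) {y : ℕ} {v u : Fin n}
    (hx : y ≠ 100) (hv : ρ y = v) (hu : ρ 7 = u) {t : Fin 5 → Fin n}
    (ht : ∀ i : Fin 5, ρ (i + 1) = t i) :
    Holds σ ρ (leads y) ↔ v = s ∨ (∃ l, v = t l) ∨ c v = c u ∧ Covered (Near G c) s t v := by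
  simp only [leads, holds_or, holds_and, holds_eq, holds_covered h h9 hx hv ht,
    Fin.exists_fin_succ]
  have h0 := ht 0
  have h1 := ht 1
  have h2 := ht 2
  have h3 := ht 3
  have h4 := ht 4
  simp at h0 h1 h2 h3 h4
  simp [eval, hv, hu, h0, h1, h2, h3, h4, source, color, h.source, h.color, Fin.val_inj]

theorem holds_free (h : IsInstance G s c σ)
    (h9 : IsTable σ 9 fun f : Fin 2 → Fin n => Avoid (Near G c) (f 0) s (f 1)) {u : Fin n}
    (hu : ρ 7 = u) {t : Fin 5 → Fin n} (ht : ∀ i : Fin 5, ρ (i + 1) = t i) :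
    Holds σ ρ free ↔ ∀ w, c w = c u → Covered (Near G c) s t w := by
  rw [free, holds_all_fin h.size]
  refine forall_congr' fun w => ?_
  rw [holds_or, holds_covered h h9 (by decide) (v := w) (t := t) (by simp) fun i => by
    rw [Function.update_of_ne (by omega), ht]]
  simp [eval, color, hu, h.color, Fin.val_inj, imp_iff_not_or]

/-- One step of the recursion for the winning states, on the level of relations. -/
def winRec (G : SimpleGraph (Fin n)) (s : Fin n) (c : Fin n → Fin k)
    (P : (Fin 6 → Fin n) → Prop) (f : Fin 6 → Fin n) : Prop :=
  (∀ v, Covered (Near G c) s (Fin.tail f) v) ∨ ∃ u t', Leads (Near G c) c s (Fin.tail f) (c u) t' ∧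
    ((∀ w, c w = c u → Covered (Near G c) s (Fin.tail f) w) ∧ P (Fin.cons (f 0) t') ∨
      ∃ e : Fin n, (e : ℕ) + 1 = f 0 ∧ P (Fin.cons e t'))

theorem exists_vec_five {α : Type*} {P : (Fin 5 → α) → Prop} :
    (∃ t, P t) ↔ ∃ v w x y z, P ![v, w, x, y, z] := by
  constructor
  · rintro ⟨t, ht⟩
    refine ⟨t 0, t 1, t 2, t 3, t 4, ?_⟩
    convert ht using 1
    ext i
    fin_cases i <;> rfl
  · rintro ⟨v, w, x, y, z, h⟩
    exact ⟨_, h⟩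

/-- Variable `0` holds the allowance and `1` to `5` the state; `7` is a vertex of the called color,
`8` to `12` the next state and `13` the diminished allowance. -/
theorem holds_winStep (h : IsInstance G s c σ)
    (h9 : IsTable σ 9 fun f : Fin 2 → Fin n => Avoid (Near G c) (f 0) s (f 1))
    {P : (Fin 6 → Fin n) → Prop} (hP : IsTable σ 11 P) (f : Fin 6 → Fin n) :
    Holds σ (withVars ρ f) winStep ↔ winRec G s c P f := by
  have ht : ∀ i : Fin 5, withVars ρ f (i + 1) = Fin.tail f i := fun i => by
    simp only [withVars, Fin.tail]
    rw [dif_pos (by omega)]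
    rfl
  simp only [winStep, winRec, holds_or, holds_finished h h9 ht, exists_vec_five,
    holds_ex_fin h.size]
  refine or_congr_right <| exists_congr fun u => exists_congr fun v₁ => exists_congr fun v₂ =>
    exists_congr fun v₃ => exists_congr fun v₄ => exists_congr fun v₅ => ?_
  set ρ' := Function.update (Function.update (Function.update (Function.update (Function.update
    (Function.update (withVars ρ f) 7 u) 8 v₁) 9 v₂) 10 v₃) 11 v₄) 12 v₅ with hρ'
  have r0 : ρ' 0 = f 0 := by simp [hρ', withVars]
  have r7 : ρ' 7 = u := by simp [hρ']
  have r8 : ρ' 8 = v₁ := by simp [hρ']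
  have r9 : ρ' 9 = v₂ := by simp [hρ']
  have r10 : ρ' 10 = v₃ := by simp [hρ']
  have r11 : ρ' 11 = v₄ := by simp [hρ']
  have r12 : ρ' 12 = v₅ := by simp [hρ']
  have ht' : ∀ i : Fin 5, ρ' (i + 1) = Fin.tail f i := fun i => by
    rw [← ht i, hρ']
    iterate 6 rw [Function.update_of_ne (by omega)]
  clear_value ρ'
  simp only [holds_and, holds_or, holds_ex_fin h.size, holds_free h h9 r7 ht',
    holds_leads h h9 (by decide) r8 r7 ht', holds_leads h h9 (by decide) r9 r7 ht',
    holds_leads h h9 (by decide) r10 r7 ht', holds_leads h h9 (by decide) r11 r7 ht',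
    holds_leads h h9 (by decide) r12 r7 ht', holds_eq,
    holds_cell (l := [0, 8, 9, 10, 11, 12]) (by decide),
    holds_cell (l := [13, 8, 9, 10, 11, 12]) (by decide), h.size]
  refine and_congr ?_ (or_congr (and_congr_right fun _ => ?_) (exists_congr fun e => ?_))
  · simp [Leads, Fin.forall_fin_succ]
  · simpa [r0, r8, r9, r10, r11, r12] using hP.six (f 0) v₁ v₂ v₃ v₄ v₅
  · simpa [eval, r0, r8, r9, r10, r11, r12] using
      fun _ => hP.six e v₁ v₂ v₃ v₄ v₅

/-- Restricting the allowance to `Fin n` loses nothing, since it only decreases. -/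
theorem winRec_iterate (r : ℕ) (f : Fin 6 → Fin n) :
    (winRec G s c)^[r] (fun f => ∀ v, Covered (Near G c) s (Fin.tail f) v) f ↔
      Wins (Near G c) c s r (f 0) (Fin.tail f) := by
  induction r generalizing f with
  | zero => rfl
  | succ r ih =>
    simp only [Function.iterate_succ_apply', winRec, Wins, ih, Fin.cons_zero, Fin.tail_cons]
    refine or_congr_right <| exists_congr fun u => exists_congr fun t' => and_congr_right fun _ =>
      or_congr_right ⟨?_, ?_⟩
    · rintro ⟨e, he, h⟩
      exact ⟨e, he, h⟩
    · rintro ⟨e, he, h⟩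
      exact ⟨⟨e, by omega⟩, he, h⟩

end Term

/-- Tabulate in array `11` the winning states. -/
def winStmt : Stmt :=
  .seq (.fill 11 (List.range 6) .finished) (.iterate 11 12 6 .winStep)

theorem exec_winStmt (h : IsInstance G s c σ)
    (h9 : IsTable σ 9 fun f : Fin 2 → Fin n => Avoid (Near G c) (f 0) s (f 1)) (ρ : ℕ → ℕ) :
    (∀ a, a ≠ 11 → a ≠ 12 → winStmt.exec ρ σ a = σ a) ∧
      IsTable (winStmt.exec ρ σ) 11 fun f : Fin 6 → Fin n =>
        Wins (Near G c) c s n (f 0) (Fin.tail f) := by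
  obtain ⟨h1, h2⟩ := Stmt.exec_fill (m := 6) (a := 11) (h := .finished) (by decide) (by decide)
    (by decide) ρ h.size
  simp only [winStmt, Stmt.exec]
  set τ := (Stmt.fill 11 (List.range 6) .finished).exec ρ σ
  have H : IsInstance G s c τ :=
    h.congr (h1 0 (by decide)) (h1 1 (by decide)) (h1 2 (by decide))
  obtain ⟨h3, h4⟩ := Stmt.exec_iterate (m := 6) (a := 11) (b := 12) (h := .winStep) (by decide)
    (by decide) (by decide) (by decide) (by decide) ρ H.size h2 (Term.winRec G s c) (by
      intro ρ υ P hυ hP f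
      refine Term.holds_winStep (H.congr (hυ 0 (by decide) (by decide)) (hυ 1 (by decide)
        (by decide)) (hυ 2 (by decide) (by decide))) (h9.congr ?_ fun _ => Iff.rfl) hP f
      rw [hυ 9 (by decide) (by decide), h1 9 (by decide)])
  refine ⟨fun a ha hb => (h3 a ha hb).trans (h1 a ha), h4.congr rfl fun f => ?_⟩
  rw [← Term.winRec_iterate]
  refine iff_of_eq (congrFun (congrArg _ (funext fun f => propext ?_)) f)
  refine Term.holds_finished h h9 fun i => ?_
  simp only [withVars, Fin.tail]
  rw [dif_pos (by omega)]
  rfl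

/-- The number of colors that occur outside of the first territory. -/
def Term.colorsLeft : Term :=
  .sum 0 <| .and (.all 1 <| .or (.neg (.lt (.var 1) (.var 0))) (.neg (.eq (.color 1) (.color 0)))) <|
    .ex 1 <| .and (.eq (.color 1) (.color 0)) <| .ex 2 <| .and (.eq (.var 2) .source) <|
      .neg (.cell 6 [2, 1])

/-- The least number of calls of colors that are not dominated. -/
def Term.extraCalls : Term :=
  .sum 0 <| .neg <| .ex 1 <| .and (.eq (.var 1) .source) (.cell 11 [0, 1, 1, 1, 1, 1])

open Classical in
theorem Term.eval_neg_eq (h : Term) (σ : Memory) (ρ : ℕ → ℕ) :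
    (Term.neg h).eval σ ρ = if h.Holds σ ρ then 0 else 1 := by
  split_ifs with H <;> simp only [Holds, neg, eval] at * <;> omega

open Classical in
theorem Term.eval_extraCalls (h : IsInstance G s c σ)
    (h11 : IsTable σ 11 fun f : Fin 6 → Fin n => Wins (Near G c) c s n (f 0) (Fin.tail f))
    (ρ : ℕ → ℕ) : Term.extraCalls.eval σ ρ = ∑ e ∈ Finset.range n,
      if Wins (Near G c) c s n e (fun _ : Fin 5 => s) then 0 else 1 := by
  rw [extraCalls, eval, h.size]
  refine Finset.sum_congr rfl fun e he => ?_
  rw [eval_neg_eq]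
  congr 1
  rw [holds_ex_fin h.size]
  simp only [holds_and, holds_cell (l := [0, 1, 1, 1, 1, 1]) (by decide), h.size]
  have key := h11.six ⟨e, Finset.mem_range.1 he⟩ s s s s s
  have : Fin.tail ![⟨e, Finset.mem_range.1 he⟩, s, s, s, s, s] = fun _ => s := by
    ext i
    fin_cases i <;> rfl
  rw [this] at key
  simpa [eval, source, h.source, Fin.val_inj] using key

-- Each color is counted at its least vertex. The conjunction evaluates to `0` or `1`, so the sum
-- really counts.
open Classical in
theorem Term.eval_colorsLeft (h : IsInstance G s c σ)
    (h6 : IsTable σ 6 fun f : Fin 2 → Fin n => SameBlock G c (f 0) (f 1)) (ρ : ℕ → ℕ) :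
    Term.colorsLeft.eval σ ρ = FloodIt.colorsLeft c {v | SameBlock G c s v} := by
  set T : Set (Fin n) := {v | SameBlock G c s v} with hT
  have hbody : ∀ u : Fin n, (Term.and (.all 1 <| .or (.neg (.lt (.var 1) (.var 0)))
      (.neg (.eq (.color 1) (.color 0)))) <| .ex 1 <| .and (.eq (.color 1) (.color 0)) <|
      .ex 2 <| .and (.eq (.var 2) .source) <| .neg (.cell 6 [2, 1])).eval σ
        (Function.update ρ 0 u) =
      if (∀ v < u, c v ≠ c u) ∧ ∃ v, c v = c u ∧ v ∉ T then 1 else 0 := by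
    intro u
    rw [and, eval_neg_eq, ← ite_not]
    refine if_congr ?_ rfl rfl
    simp only [holds_or, holds_neg, holds_all_fin h.size, holds_ex_fin h.size,
      holds_and, holds_lt, holds_eq, holds_cell (l := [2, 1]) (by decide), h.size]
    simp [eval, color, source, h.color, h.source, Fin.val_inj, h6.pair, hT, imp_iff_not_or]
  rw [colorsLeft, eval, h.size, ← Fin.sum_univ_eq_sum_range
    (fun j => Term.eval σ _ (Function.update ρ 0 j))]
  simp only [hbody, Finset.sum_boole, Nat.cast_id]
  rw [FloodIt.colorsLeft, ← Set.ncard_coe_finset]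
  refine Set.ncard_congr (fun u _ => c u) ?_ ?_ ?_
  · intro u hu
    simp only [Finset.coe_filter, Finset.mem_univ, true_and, Set.mem_ofPred_eq] at hu
    obtain ⟨-, v, hv, hvT⟩ := hu
    exact ⟨v, hvT, hv⟩
  · intro u v hu hv huv
    simp only [Finset.coe_filter, Finset.mem_univ, true_and, Set.mem_ofPred_eq] at hu hv
    exact le_antisymm (not_lt.1 fun hlt => hu.1 v hlt huv.symm)
      (not_lt.1 fun hlt => hv.1 u hlt huv)
  · rintro _ ⟨v, hv, rfl⟩
    obtain ⟨u, hu, hmin⟩ := (Finset.univ.filter fun u => c u = c v).exists_minimal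
      ⟨v, by simp⟩
    simp only [Finset.mem_filter, Finset.mem_univ, true_and] at hu hmin
    refine ⟨u, ?_, hu⟩
    simp only [Finset.coe_filter, Finset.mem_univ, true_and, Set.mem_ofPred_eq]
    exact ⟨fun w hw hc => absurd (hmin (hc.trans hu) hw.le) (not_le.2 hw), v, hu.symm, hv⟩

/-- The algorithm. -/
def minMovesStmt : Stmt :=
  .seq blockStmt <| .seq nearStmt <| .seq avoidStmt <| .seq winStmt <|
    .assign 3 (.lit 0) (.add .colorsLeft .extraCalls)

theorem ok_minMovesStmt : minMovesStmt.Ok :=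
  ⟨Stmt.ok_closure (by decide) (by decide) (by decide) (by decide),
    Stmt.ok_fill (by decide) (by decide),
    Stmt.ok_closure (by decide) (by decide) (by decide) (by decide),
    ⟨Stmt.ok_fill (by decide) (by decide), Stmt.ok_iterate (by decide) (by decide) (by decide)⟩,
    by decide, by decide, by decide⟩

theorem isMinMoves_exec (hc : G.Connected) (hG : ATFree G) (h : IsInstance G s c σ) (ρ : ℕ → ℕ) :
    IsMinMoves G s c (output (minMovesStmt.exec ρ σ)) := by
  obtain ⟨a1, a2⟩ := exec_blockStmt h ρ
  simp only [minMovesStmt, Stmt.exec]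
  set σ₁ := blockStmt.exec ρ σ
  have H₁ : IsInstance G s c σ₁ := h.congr (a1 0 (by decide) (by decide))
    (a1 1 (by decide) (by decide)) (a1 2 (by decide) (by decide))
  obtain ⟨b1, b2⟩ := exec_nearStmt H₁ a2 ρ
  set σ₂ := nearStmt.exec ρ σ₁
  have H₂ : IsInstance G s c σ₂ := H₁.congr (b1 0 (by decide)) (b1 1 (by decide))
    (b1 2 (by decide))
  obtain ⟨c1, c2⟩ := exec_avoidStmt H₂ b2 ρ
  set σ₃ := avoidStmt.exec ρ σ₂
  have H₃ : IsInstance G s c σ₃ := H₂.congr (c1 0 (by decide) (by decide))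
    (c1 1 (by decide) (by decide)) (c1 2 (by decide) (by decide))
  obtain ⟨d1, d2⟩ := exec_winStmt H₃ c2 ρ
  set σ₄ := winStmt.exec ρ σ₃
  have H₄ : IsInstance G s c σ₄ := H₃.congr (d1 0 (by decide) (by decide))
    (d1 1 (by decide) (by decide)) (d1 2 (by decide) (by decide))
  have e6 : IsTable σ₄ 6 fun f : Fin 2 → Fin n => SameBlock G c (f 0) (f 1) :=
    a2.congr (by rw [d1 6 (by decide) (by decide), c1 6 (by decide) (by decide),
      b1 6 (by decide)]) fun _ => Iff.rfl
  rw [output, Term.eval, Memory.write_same, Term.eval, Term.eval_colorsLeft H₄ e6,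
    Term.eval_extraCalls H₄ d2]
  exact isMinMoves_of_atFree hc hG s c

end FloodIt

theorem mainTheorem1 :
    ∃ (p : FloodIt.Prog) (C d : ℕ),
      ∀ (n k : ℕ) (G : SimpleGraph (Fin n)) (s : Fin n) (c : Fin n → Fin k),
        G.Connected → FloodIt.ATFree G →
          ∃ (τ : FloodIt.Memory) (t : ℕ),
            FloodIt.Runs p (FloodIt.input G s c) τ t ∧ t ≤ C * n ^ d ∧
              FloodIt.IsMinMoves G s c (FloodIt.output τ) := by
  obtain ⟨C, d, hCd⟩ := FloodIt.minMovesStmt.polyBounded_time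
  refine ⟨FloodIt.minMovesStmt.comp 0, C, d, fun n k G s c hc hG => ?_⟩
  have h := FloodIt.isInstance_input G s c
  obtain ⟨τ, t, hr, ht, ha, -⟩ :=
    FloodIt.minMovesStmt.exists_runs_comp FloodIt.ok_minMovesStmt 0 (FloodIt.input G s c)
  refine ⟨τ, t, hr, ?_, ?_⟩
  · rw [h.size] at ht
    -- The source is a vertex, so `n` is positive and the monomial bound applies.
    exact ht.trans (hCd n (Nat.one_le_iff_ne_zero.2 fun hn => (hn ▸ s).elim0))
  · rw [FloodIt.output, ha 3 (by decide) (by decide)]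
    exact FloodIt.isMinMoves_exec hc hG h _
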